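/- Fix $\delta,\lambda\in\mathbb R$ with $\lambda>0$. For $k\ge 1$ let $H^k_{per}$ be the space of $f\in H^k([0,2\pi];\mathbb R^2)$ with $\partial_x^\ell f(0)=\partial_x^\ell f(2\pi)$ for $0\le \ell\le k-1$, and let $H^2_{imm}$ be the set of $\gamma\in H^2_{per}$ with $\partial_x\gamma\neq 0$ everywhere. Let $C^\infty_{per}$ be the space of $f\in C^\infty([0,2\pi];\mathbb R^2)$ with $f^{(\ell)}(0)=f^{(\ell)}(2\pi)$ for all $\ell\ge 0$. For $\gamma\in H^2_{imm}$ put $\partial_s f=|\partial_x\gamma|^{-1}\partial_x f$, $ds=|\partial_x\gamma|\,dx$, $L(\gamma)=\int_0^{2\pi}|\partial_x\gamma|\,dx$, $\tau=\partial_s\gamma$, $\nu=J\tau$ with $J$ the counterclockwise rotation by $\pi/2$, and define $\kappa$ by $\partial_s\tau=\kappa\nu$. For $\eta\in H^1_{per}$ put $\operatorname{div}_\gamma\eta=\langle\partial_s\eta,\tau\rangle$, $\nabla_\gamma\eta=\partial_s\eta\otimes\tau$ and $$E_{LM}(\gamma,\eta)=\frac12\int_\gamma(\kappa+\delta\operatorname{div}_\gamma\eta)^2\,ds+\frac{\lambda}{2}\int_\gamma|\nabla_\gamma\eta|^2\,ds+L(\gamma).$$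 A pair $(\gamma,\eta)\in H^2_{imm}\times H^1_{per}$ is a critical point of $E_{LM}$ if $\frac{d}{d\varepsilon}\big|_{\varepsilon=0}E_{LM}(\gamma+\varepsilon\varphi,\eta+\varepsilon\psi)=0$ for all $(\varphi,\psi)\in H^2_{per}\times H^1_{per}$. Theorem. Let $(\gamma,\eta)\in H^2_{imm}\times H^1_{per}$ be a critical point of $E_{LM}$ with $\gamma$ parametrized proportionally to arc length, that is, $|\partial_x\gamma(x)|=L(\gamma)/2\pi$ for all $x$. Then $\gamma,\eta\in C^\infty_{per}$. Moreover, for every integer $k\ge 0$ there is a function $C_k:\mathbb R\times\mathbb R\to\mathbb R$, depending only on $k,\delta,\lambda$, such that every such critical point satisfies $$\|\gamma\|_{W^{k+2,\infty}}+\|\eta\|_{W^{k+1,\infty}}\le C_k\big(\|\gamma\|_{H^2},\|\eta\|_{H^1}\big).$$ -/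

import Mathlib

open MeasureTheory Set
open scoped ContDiff ENNReal

noncomputable section

namespace SurfactantCurve

/-- The Euclidean plane. -/
abbrev Plane : Type := EuclideanSpace ℝ (Fin 2)

/-- Lebesgue measure on one period `[0, 2π]`. -/
def periodMeasure : Measure ℝ := volume.restrict (Icc 0 (2 * Real.pi))

/-- `g` is the weak derivative of `f` on `ℝ`: both functions are locally integrable, and
`∫ ζ' f = - ∫ ζ g` for every smooth, compactly supported test function `ζ`. -/
def IsWeakDeriv (f g : ℝ → Plane) : Prop :=
  LocallyIntegrable f volume ∧ LocallyIntegrable g volume ∧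
    ∀ ζ : ℝ → ℝ, ContDiff ℝ ∞ ζ → HasCompactSupport ζ →
      ∫ x, deriv ζ x • f x = - ∫ x, ζ x • g x

/-- The periodic Sobolev space `H^k_per([0,2π]; ℝ²)` for `k ≥ 1`, its elements being extended
`2π`-periodically to `ℝ` and identified with their continuous representatives. All weak
derivatives up to order `k` exist across the period points, which says that the derivatives of
order less than `k` agree at `0` and `2π`, and they are square integrable over a period. -/
structure MemHPer (k : ℕ) (f : ℝ → Plane) : Prop where
  periodic : Function.Periodic f (2 * Real.pi)
  continuous : Continuous f
  weakDeriv : ∃ D : ℕ → ℝ → Plane, D 0 = f ∧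
    (∀ j < k, IsWeakDeriv (D j) (D (j + 1))) ∧ ∀ j ≤ k, MemLp (D j) 2 periodMeasure

/-- The set `H²_imm` of closed regular curves of class `H²`. An `H²` function is of class `C¹`, so
`deriv γ` is its classical derivative. -/
structure MemHImm (γ : ℝ → Plane) : Prop where
  memHPer : MemHPer 2 γ
  regular : ∀ x, deriv γ x ≠ 0

/-- The space `C^∞_per`: smooth functions whose derivatives of every order agree at `0` and `2π`,
extended periodically to `ℝ`. -/
structure MemCInftyPer (f : ℝ → Plane) : Prop where
  periodic : Function.Periodic f (2 * Real.pi)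
  contDiff : ContDiff ℝ ∞ f

/-- The norm of `H^k([0,2π]; ℝ²)`. For the continuous representative of an `H^k` function the
iterated derivatives up to order `k` exist almost everywhere and are the weak derivatives. -/
def hNorm (k : ℕ) (f : ℝ → Plane) : ℝ :=
  Real.sqrt (∑ j ∈ Finset.range (k + 1),
    ∫ x in (0 : ℝ)..(2 * Real.pi), ‖iteratedDeriv j f x‖ ^ 2)

/-- The norm of `W^{k,∞}([0,2π]; ℝ²)`, the sum of the essential suprema of the derivatives up to
order `k`; it takes the value `∞` where one of them is unbounded. It is used for smooth functions
only. -/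
def wInftyNorm (k : ℕ) (f : ℝ → Plane) : ℝ≥0∞ :=
  ∑ j ∈ Finset.range (k + 1), eLpNorm (iteratedDeriv j f) ∞ periodMeasure

/-- Counterclockwise rotation of the plane by `π/2`. -/
def rot (v : Plane) : Plane := !₂[-(v 1), v 0]

/-- The arc length derivative `∂_s f = |∂_x γ|⁻¹ ∂_x f` along `γ`. -/
def arcDeriv (γ f : ℝ → Plane) (x : ℝ) : Plane := ‖deriv γ x‖⁻¹ • deriv f x

/-- The unit tangent `τ = ∂_s γ`. -/
def tangent (γ : ℝ → Plane) : ℝ → Plane := arcDeriv γ γ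

/-- The unit normal `ν = J τ`. -/
def normal (γ : ℝ → Plane) (x : ℝ) : Plane := rot (tangent γ x)

/-- The oriented curvature `κ`, that is, the coefficient in `∂_s τ = κ ν`. -/
def curvature (γ : ℝ → Plane) (x : ℝ) : ℝ :=
  inner ℝ (arcDeriv γ (tangent γ) x) (normal γ x)

/-- The divergence `div_γ η = ⟨∂_s η, τ⟩`. -/
def curveDiv (γ η : ℝ → Plane) (x : ℝ) : ℝ :=
  inner ℝ (arcDeriv γ η x) (tangent γ x)

/-- The gradient `∇_γ η = ∂_s η ⊗ τ`, whose rows are the gradients of the components. -/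
def curveGrad (γ η : ℝ → Plane) (x : ℝ) : Matrix (Fin 2) (Fin 2) ℝ :=
  Matrix.of fun i j => arcDeriv γ η x i * tangent γ x j

/-- The squared Euclidean (Frobenius) norm of a matrix. -/
def matrixNormSq (M : Matrix (Fin 2) (Fin 2) ℝ) : ℝ := ∑ i, ∑ j, M i j ^ 2

/-- The integral `∫_γ f ds`. -/
def curveIntegral (γ : ℝ → Plane) (f : ℝ → ℝ) : ℝ :=
  ∫ x in (0 : ℝ)..(2 * Real.pi), f x * ‖deriv γ x‖

/-- The length of `γ` over one period. -/
def curveLength (γ : ℝ → Plane) : ℝ := ∫ x in (0 : ℝ)..(2 * Real.pi), ‖deriv γ x‖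

/-- The energy
`E_LM(γ, η) = 1/2 ∫_γ (κ + δ div_γ η)² ds + lam/2 ∫_γ |∇_γ η|² ds + L(γ)`. -/
def energyLM (δ lam : ℝ) (γ η : ℝ → Plane) : ℝ :=
  1 / 2 * curveIntegral γ (fun x => (curvature γ x + δ * curveDiv γ η x) ^ 2)
    + lam / 2 * curveIntegral γ (fun x => matrixNormSq (curveGrad γ η x))
    + curveLength γ

/-- `γ` is parametrized proportionally to arc length: `|∂_x γ| = L(γ) / 2π` everywhere. -/
def IsProportionalToArcLength (γ : ℝ → Plane) : Prop :=
  ∀ x, ‖deriv γ x‖ = curveLength γ / (2 * Real.pi)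

/-- `(γ, η)` is a critical point of `E_LM`: the first variation of the energy vanishes in every
direction `(φ, ψ) ∈ H²_per × H¹_per`. -/
def IsCriticalPoint (δ lam : ℝ) (γ η : ℝ → Plane) : Prop :=
  ∀ φ ψ : ℝ → Plane, MemHPer 2 φ → MemHPer 1 ψ →
    HasDerivAt (fun ε : ℝ => energyLM δ lam (γ + ε • φ) (η + ε • ψ)) 0 0

end SurfactantCurve

end

/-! Write p = ∂ₓγ, m = ∂ₓ²γ, h = ∂ₓη, c = |p|, w = κ + δ div_γ η and J for `rot`. The energy is the
integral of a density F(p, m, h). Variations of η say that F_h is orthogonal to all mean-zero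
functions, hence constant, so h = λ⁻¹(a − δ w p). Variations of γ say that F_m agrees a.e. with a
primitive V of F_p − b, where b is the mean of F_p. As F_p is only integrable, V is at first just
absolutely continuous.

Since F_m = c⁻² w Jp, the pairing W = ⟨V, Jp⟩ is a continuous representative of w. Inserting h into
the definition of w, and using m ⊥ p (constant speed), expresses m through W, p and a
(`inner_rot_eq_of_eq`). In W' = ⟨F_p − b, Jp⟩ + ⟨V, Jm⟩ the last term vanishes and the quadratic
part of F_p is a multiple of p, so that W' is affine in W (`inner_densityDerivP_rot`). Thus p, W and
η solve a first order system whose right-hand side is polynomial in p and W, and continuity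
bootstraps to smoothness.

For the estimates one bounds a, b, c, c⁻¹ and sup |W|. The delicate one is c⁻¹: the dilation γ ↦ (1
+ ε)γ balances quadratic energy and length, giving ∫ w² ≤ 4π and ∫ |h|² ≤ 4πc²/λ; as p has mean
zero, c ≤ ∫ |m|, and the right side is O(c²). The bootstrap is run on the family of all critical
points with given norms at once (`UniformlySmooth`), so the bounds survive each differentiation. -/

namespace SurfactantCurve

/-! ### Indefinite integrals and their calculus -/

/-- `f` is an indefinite integral of the locally integrable function `g`. -/
structure IsPrimitive {E : Type*} [NormedAddCommGroup E] [NormedSpace ℝ E] (f g : ℝ → E) :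
    Prop where
  locallyIntegrable : LocallyIntegrable g volume
  integral_eq : ∀ x y, ∫ t in x..y, g t = f y - f x

theorem _root_.MeasureTheory.LocallyIntegrable.intervalIntegrable' {E : Type*}
    [NormedAddCommGroup E] {g : ℝ → E} (hg : LocallyIntegrable g volume) (x y : ℝ) :
    IntervalIntegrable g volume x y :=
  intervalIntegrable_iff.mpr <|
    (hg.integrableOn_isCompact isCompact_uIcc).mono_set uIoc_subset_uIcc

theorem locallyIntegrable_of_intervalIntegrable {E : Type*} [NormedAddCommGroup E] {g : ℝ → E}
    (hg : ∀ x y, IntervalIntegrable g volume x y) : LocallyIntegrable g volume := by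
  intro x
  refine ⟨Icc (x - 1) (x + 1), Icc_mem_nhds (by linarith) (by linarith), ?_⟩
  have := hg (x - 1) (x + 1)
  rwa [intervalIntegrable_iff_integrableOn_Icc_of_le (by linarith)] at this

theorem periodic_deriv {E : Type*} [NormedAddCommGroup E] [NormedSpace ℝ E] {f : ℝ → E} {T : ℝ}
    (hf : Function.Periodic f T) : Function.Periodic (deriv f) T := by
  intro x
  rw [← deriv_comp_add_const]
  congr 1
  funext y
  exact hf y

namespace IsPrimitive

section General

variable {E F : Type*} [NormedAddCommGroup E] [NormedSpace ℝ E] [NormedAddCommGroup F]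
  [NormedSpace ℝ F] {f g : ℝ → E}

theorem intervalIntegrable (h : IsPrimitive f g) (x y : ℝ) : IntervalIntegrable g volume x y :=
  h.locallyIntegrable.intervalIntegrable' x y

theorem eq_add_integral (h : IsPrimitive f g) (x : ℝ) : f = fun y => f x + ∫ t in x..y, g t := by
  funext y
  simp [h.integral_eq x y]

theorem continuous (h : IsPrimitive f g) : Continuous f := by
  rw [h.eq_add_integral 0]
  exact continuous_const.add (intervalIntegral.continuous_primitive h.intervalIntegrable 0)

theorem ae_hasDerivAt [CompleteSpace E] (h : IsPrimitive f g) : ∀ᵐ x, HasDerivAt f (g x) x := by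
  filter_upwards [_root_.LocallyIntegrable.ae_hasDerivAt_integral h.locallyIntegrable] with x hx
  rw [h.eq_add_integral 0]
  exact (hx 0).const_add _

theorem congr_ae (h : IsPrimitive f g) {g' : ℝ → E} (hg : g =ᵐ[volume] g') : IsPrimitive f g' where
  locallyIntegrable := (locallyIntegrable_congr hg).1 h.locallyIntegrable
  integral_eq x y := by
    rw [← h.integral_eq x y]
    exact intervalIntegral.integral_congr_ae (by filter_upwards [hg] with t ht _ using ht.symm)

theorem ae_deriv_eq [CompleteSpace E] (h : IsPrimitive f g) : deriv f =ᵐ[volume] g := by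
  filter_upwards [h.ae_hasDerivAt] with x hx using hx.deriv

/-- The source of every gain in regularity: once the weak derivative is a.e. equal to a continuous
function, the fundamental theorem of calculus makes that function the classical derivative
everywhere. -/
theorem hasDerivAt [CompleteSpace E] (h : IsPrimitive f g) {g' : ℝ → E} (hg : g =ᵐ[volume] g')
    (hc : Continuous g') (x : ℝ) : HasDerivAt f (g' x) x := by
  rw [(h.congr_ae hg).eq_add_integral 0]
  exact ((hc.integral_hasStrictDerivAt 0 x).hasDerivAt).const_add _

theorem of_hasDerivAt [CompleteSpace E] (h : ∀ x, HasDerivAt f (g x) x) (hc : Continuous g) :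
    IsPrimitive f g where
  locallyIntegrable := hc.locallyIntegrable
  integral_eq x y := intervalIntegral.integral_eq_sub_of_hasDerivAt (fun t _ => h t)
    (hc.intervalIntegrable x y)

theorem of_integral (hg : LocallyIntegrable g volume) (a : E) :
    IsPrimitive (fun x => a + ∫ t in (0 : ℝ)..x, g t) g where
  locallyIntegrable := hg
  integral_eq x y := by
    rw [add_sub_add_left_eq_sub, intervalIntegral.integral_interval_sub_left] <;>
      exact hg.intervalIntegrable' _ _

theorem clm [CompleteSpace E] [CompleteSpace F] (h : IsPrimitive f g) (L : E →L[ℝ] F) :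
    IsPrimitive (fun x => L (f x)) (fun x => L (g x)) where
  locallyIntegrable := locallyIntegrable_of_intervalIntegrable fun x y =>
    ⟨L.integrable_comp (h.intervalIntegrable x y).1, L.integrable_comp (h.intervalIntegrable x y).2⟩
  integral_eq x y := by
    rw [L.intervalIntegral_comp_comm (h.intervalIntegrable x y), h.integral_eq, map_sub]

theorem add {f' g' : ℝ → E} (h : IsPrimitive f g) (h' : IsPrimitive f' g') :
    IsPrimitive (fun x => f x + f' x) (fun x => g x + g' x) where
  locallyIntegrable := h.locallyIntegrable.add h'.locallyIntegrable
  integral_eq x y := by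
    rw [intervalIntegral.integral_add (h.intervalIntegrable x y) (h'.intervalIntegrable x y),
      h.integral_eq, h'.integral_eq]
    abel

theorem sub_const (h : IsPrimitive f g) (a : E) : IsPrimitive (fun x => f x - a) g where
  locallyIntegrable := h.locallyIntegrable
  integral_eq x y := by rw [h.integral_eq]; abel

end General

theorem absolutelyContinuousOnInterval {f g : ℝ → ℝ} (h : IsPrimitive f g) (a b : ℝ) :
    AbsolutelyContinuousOnInterval f a b := by
  have h1 := (h.intervalIntegrable a b).absolutelyContinuousOnInterval_intervalIntegral
    (c := a) (by simp)
  have h2 : AbsolutelyContinuousOnInterval (fun _ : ℝ => f a) a b :=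
    (LipschitzWith.const (f a)).lipschitzOnWith.absolutelyContinuousOnInterval
  rw [h.eq_add_integral a]
  exact h2.add h1

/-- Both factors are absolutely continuous, so integration by parts holds although the derivatives
exist only a.e. -/
theorem mul {f g f' g' : ℝ → ℝ} (h : IsPrimitive f g) (h' : IsPrimitive f' g') :
    IsPrimitive (fun x => f x * f' x) (fun x => g x * f' x + f x * g' x) where
  locallyIntegrable := locallyIntegrable_of_intervalIntegrable fun x y =>
    ((h.intervalIntegrable x y).mul_continuousOn h'.continuous.continuousOn).add
      ((h'.intervalIntegrable x y).continuousOn_mul h.continuous.continuousOn)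
  integral_eq x y := by
    rw [← AbsolutelyContinuousOnInterval.integral_deriv_mul_eq_sub
      (h.absolutelyContinuousOnInterval x y) (h'.absolutelyContinuousOnInterval x y)]
    refine intervalIntegral.integral_congr_ae ?_
    filter_upwards [h.ae_deriv_eq, h'.ae_deriv_eq] with t ht ht' _
    rw [ht, ht']

theorem coord {f g : ℝ → Plane} (h : IsPrimitive f g) (i : Fin 2) :
    IsPrimitive (fun x => f x i) (fun x => g x i) :=
  h.clm (EuclideanSpace.proj i : Plane →L[ℝ] ℝ)

theorem inner {f g f' g' : ℝ → Plane} (h : IsPrimitive f g) (h' : IsPrimitive f' g') :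
    IsPrimitive (fun x => inner ℝ (f x) (f' x))
      (fun x => inner ℝ (g x) (f' x) + inner ℝ (f x) (g' x)) := by
  have := ((h.coord 0).mul (h'.coord 0)).add ((h.coord 1).mul (h'.coord 1))
  convert! this using 2
  · simp [PiLp.inner_apply, Fin.sum_univ_two]; ring
  · simp [PiLp.inner_apply, Fin.sum_univ_two]; ring

theorem smul {ζ ζ' : ℝ → ℝ} {f g : ℝ → Plane} (h : IsPrimitive ζ ζ') (h' : IsPrimitive f g) :
    IsPrimitive (fun x => ζ x • f x) (fun x => ζ' x • f x + ζ x • g x) where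
  locallyIntegrable := locallyIntegrable_of_intervalIntegrable fun x y =>
    ((h.intervalIntegrable x y).smul_continuousOn h'.continuous.continuousOn).add
      ((h'.intervalIntegrable x y).continuousOn_smul h.continuous.continuousOn)
  integral_eq x y := by
    have hint : IntervalIntegrable (fun x => ζ' x • f x + ζ x • g x) volume x y :=
      ((h.intervalIntegrable x y).smul_continuousOn h'.continuous.continuousOn).add
        ((h'.intervalIntegrable x y).continuousOn_smul h.continuous.continuousOn)
    -- Coordinate projections commute with the integral, which reduces the claim to the scalar
    -- product rule.
    ext i
    have h1 := (h.mul (h'.coord i)).integral_eq x y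
    have h2 := (EuclideanSpace.proj i : Plane →L[ℝ] ℝ).intervalIntegral_comp_comm hint
    simp only [PiLp.proj_apply] at h2
    rw [← h2]
    simpa using h1

end IsPrimitive

/-! ### Weak derivatives and absolutely continuous representatives -/

theorem IsPrimitive.isWeakDeriv {f g : ℝ → Plane} (h : IsPrimitive f g) : IsWeakDeriv f g := by
  refine ⟨h.continuous.locallyIntegrable, h.locallyIntegrable, fun ζ hζ hsupp => ?_⟩
  have hζ1 : ContDiff ℝ 1 ζ := hζ.of_le (by exact_mod_cast le_top)
  have hd : Continuous (deriv ζ) := hζ1.continuous_deriv le_rfl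
  have hP : IsPrimitive ζ (deriv ζ) := IsPrimitive.of_hasDerivAt
    (fun x => (hζ1.differentiable one_ne_zero x).hasDerivAt) hd
  -- The product rule for ζ • f is integrated over (−R, R], where R is so large that ζ vanishes at
  -- both endpoints.
  have h1 := hP.smul h
  have i1 : Integrable (fun x => deriv ζ x • f x) volume :=
    (hd.smul h.continuous).integrable_of_hasCompactSupport hsupp.deriv.smul_right
  have i2 : Integrable (fun x => ζ x • g x) volume :=
    h.locallyIntegrable.integrable_smul_left_of_hasCompactSupport hζ.continuous hsupp
  obtain ⟨R, hR0, hR⟩ := hsupp.isCompact.isBounded.exists_pos_norm_lt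
  have hz : ∀ x, R ≤ |x| → ζ x = 0 := by
    intro x hx
    by_contra hne
    have := hR x (subset_tsupport _ hne)
    rw [Real.norm_eq_abs] at this
    linarith
  have hsub : Function.support (fun x => deriv ζ x • f x + ζ x • g x) ⊆ Ioc (-R) R := by
    intro x hx
    by_contra hx'
    apply hx
    have hxt : x ∉ tsupport ζ := by
      intro hm
      have := hR x hm
      rw [Real.norm_eq_abs, abs_lt] at this
      exact hx' ⟨this.1, this.2.le⟩
    have hxt' : x ∉ tsupport (deriv ζ) := fun hm => hxt (tsupport_deriv_subset hm)
    simp [image_eq_zero_of_notMem_tsupport hxt, image_eq_zero_of_notMem_tsupport hxt']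
  have h2 := h1.integral_eq (-R) R
  rw [intervalIntegral.integral_eq_integral_of_support_subset hsub, integral_add i1 i2,
    hz R (le_abs_self R), hz (-R) (by rw [abs_neg]; exact le_abs_self R)] at h2
  rw [eq_neg_iff_add_eq_zero, h2]
  simp

/-- The primitive starting left of the support is constant to the right of it, and that constant is
the total integral. -/
theorem exists_primitive_hasCompactSupport {θ : ℝ → ℝ} (hθ : ContDiff ℝ ∞ θ)
    (hs : HasCompactSupport θ) (h0 : ∫ x, θ x = 0) :
    ∃ ζ : ℝ → ℝ, ContDiff ℝ ∞ ζ ∧ HasCompactSupport ζ ∧ deriv ζ = θ := by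
  obtain ⟨R, hR0, hR⟩ := hs.isCompact.isBounded.exists_pos_norm_lt
  have hz : ∀ x, R ≤ |x| → θ x = 0 := by
    intro x hx
    by_contra hne
    have := hR x (subset_tsupport _ hne)
    rw [Real.norm_eq_abs] at this
    linarith
  have hsub : Function.support θ ⊆ Ioc (-R) R := by
    intro x hx
    have := hR x (subset_tsupport _ hx)
    rw [Real.norm_eq_abs, abs_lt] at this
    exact ⟨this.1, this.2.le⟩
  have hd : ∀ x, HasDerivAt (fun x => ∫ t in (-R)..x, θ t) (θ x) x := fun x =>
    (hθ.continuous.integral_hasStrictDerivAt _ x).hasDerivAt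
  have hde : deriv (fun x => ∫ t in (-R)..x, θ t) = θ := funext fun x => (hd x).deriv
  refine ⟨fun x => ∫ t in (-R)..x, θ t, ?_, ?_, hde⟩
  · rw [contDiff_infty_iff_deriv, hde]
    exact ⟨fun x => (hd x).differentiableAt, hθ⟩
  · refine HasCompactSupport.intro (isCompact_Icc (a := -R) (b := R)) fun x hx => ?_
    rw [mem_Icc, not_and_or, not_le, not_le] at hx
    rcases hx with hx | hx
    · rw [intervalIntegral.integral_symm, neg_eq_zero]
      refine intervalIntegral.integral_zero_ae (Filter.Eventually.of_forall fun t ht => ?_)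
      rw [uIoc_of_le hx.le] at ht
      exact hz t (by rw [le_abs]; right; linarith [ht.2])
    · rw [intervalIntegral.integral_eq_integral_of_support_subset, h0]
      exact hsub.trans (Ioc_subset_Ioc_right hx.le)

/-- The du Bois-Reymond lemma. With χ of integral one, θ − (∫ θ) χ has mean zero and is thus the
derivative of a test function, so ∫ θ u = (∫ θ) ∫ χ u for every θ. -/
theorem ae_const_of_integral_deriv_smul_eq_zero {u : ℝ → Plane} (hu : LocallyIntegrable u volume)
    (h : ∀ ζ : ℝ → ℝ, ContDiff ℝ ∞ ζ → HasCompactSupport ζ → ∫ x, deriv ζ x • u x = 0) :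
    ∃ d : Plane, ∀ᵐ x, u x = d := by
  obtain ⟨χ, hχs, hχc, hχ1⟩ : ∃ χ : ℝ → ℝ, ContDiff ℝ ∞ χ ∧ HasCompactSupport χ ∧ ∫ x, χ x = 1 := by
    let φ : ContDiffBump (0 : ℝ) := ⟨1, 2, one_pos, one_lt_two⟩
    exact ⟨φ.normed volume, φ.contDiff_normed, φ.hasCompactSupport_normed, φ.integral_normed⟩
  refine ⟨∫ x, χ x • u x, ?_⟩
  suffices H : ∀ᵐ x, u x - (∫ x, χ x • u x) = 0 by
    filter_upwards [H] with x hx using sub_eq_zero.1 hx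
  refine ae_eq_zero_of_integral_contDiff_smul_eq_zero
    (hu.sub (continuous_const.locallyIntegrable)) fun θ hθ hθc => ?_
  have hint : ∀ {θ : ℝ → ℝ}, ContDiff ℝ ∞ θ → HasCompactSupport θ → Integrable θ volume :=
    fun h1 h2 => h1.continuous.integrable_of_hasCompactSupport h2
  have hints : ∀ {θ : ℝ → ℝ}, ContDiff ℝ ∞ θ → HasCompactSupport θ →
      Integrable (fun x => θ x • u x) volume := fun h1 h2 =>
    hu.integrable_smul_left_of_hasCompactSupport h1.continuous h2
  have hχ' : ContDiff ℝ ∞ (fun x => (∫ t, θ t) * χ x) := contDiff_const.mul hχs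
  have hχc' : HasCompactSupport (fun x => (∫ t, θ t) * χ x) := hχc.mul_left
  obtain ⟨ζ, hζ1, hζ2, hζ3⟩ := exists_primitive_hasCompactSupport
    (θ := θ - fun x => (∫ t, θ t) * χ x) (hθ.sub hχ') (hθc.sub hχc') (by
      simp only [Pi.sub_apply]
      rw [integral_sub (hint hθ hθc) (hint hχ' hχc'), integral_const_mul, hχ1, mul_one, sub_self])
  have h1 := h ζ hζ1 hζ2
  rw [hζ3] at h1
  simp only [Pi.sub_apply, sub_smul] at h1
  rw [integral_sub (hints hθ hθc) (hints hχ' hχc')] at h1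
  simp only [mul_smul] at h1
  rw [integral_smul] at h1
  simp only [smul_sub]
  rw [integral_sub (hints hθ hθc) ((hint hθ hθc).smul_const _), integral_smul_const, h1]

/-- The difference of `f` and a primitive of `g` has weak derivative zero, hence is a.e. constant.
-/
theorem IsWeakDeriv.exists_isPrimitive {f g : ℝ → Plane} (h : IsWeakDeriv f g) :
    ∃ F, IsPrimitive F g ∧ f =ᵐ[volume] F := by
  obtain ⟨hf, hg, hw⟩ := h
  have h0 := IsPrimitive.of_integral hg 0
  obtain ⟨d, hd⟩ := ae_const_of_integral_deriv_smul_eq_zero (hf.sub h0.continuous.locallyIntegrable)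
    fun ζ hζ hζc => by
      have hd : Continuous (deriv ζ) := hζ.continuous_deriv (by exact_mod_cast le_top)
      simp only [Pi.sub_apply, smul_sub]
      rw [integral_sub, hw ζ hζ hζc, h0.isWeakDeriv.2.2 ζ hζ hζc, sub_self]
      · exact hf.integrable_smul_left_of_hasCompactSupport hd hζc.deriv
      · exact h0.continuous.locallyIntegrable.integrable_smul_left_of_hasCompactSupport hd hζc.deriv
  refine ⟨_, IsPrimitive.of_integral hg d, ?_⟩
  filter_upwards [hd] with x hx
  simp only [Pi.sub_apply, zero_add] at hx
  rw [← hx]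
  abel

/-! ### Integration over one period -/

instance : IsFiniteMeasure periodMeasure := by
  unfold periodMeasure; infer_instance

theorem two_pi_pos : (0 : ℝ) < 2 * Real.pi := Real.two_pi_pos

theorem ae_periodMeasure_of_ae {P : ℝ → Prop} (h : ∀ᵐ x, P x) : ∀ᵐ x ∂periodMeasure, P x :=
  ae_restrict_of_ae h

theorem integral_periodMeasure {E : Type*} [NormedAddCommGroup E] [NormedSpace ℝ E] (f : ℝ → E) :
    ∫ x, f x ∂periodMeasure = ∫ x in (0 : ℝ)..(2 * Real.pi), f x := by
  rw [intervalIntegral.integral_of_le two_pi_pos.le, periodMeasure, integral_Icc_eq_integral_Ioc]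

theorem integrable_periodMeasure_iff {E : Type*} [NormedAddCommGroup E] {f : ℝ → E} :
    Integrable f periodMeasure ↔ IntervalIntegrable f volume 0 (2 * Real.pi) := by
  rw [intervalIntegrable_iff_integrableOn_Icc_of_le two_pi_pos.le, periodMeasure, IntegrableOn]

theorem _root_.Function.Periodic.locallyIntegrable {E : Type*} [NormedAddCommGroup E] {f : ℝ → E}
    (hp : Function.Periodic f (2 * Real.pi)) (hf : Integrable f periodMeasure) :
    LocallyIntegrable f volume :=
  locallyIntegrable_of_intervalIntegrable fun x y =>
    hp.intervalIntegrable (t := 0) two_pi_pos.ne'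
      (by rw [zero_add]; exact integrable_periodMeasure_iff.1 hf) x y

theorem _root_.Continuous.memLp_periodMeasure {E : Type*} [NormedAddCommGroup E] {f : ℝ → E}
    (hf : Continuous f) (p : ℝ≥0∞) : MemLp f p periodMeasure := by
  obtain ⟨C, hC⟩ := isCompact_Icc.exists_bound_of_continuousOn
    (f := f) (s := Icc 0 (2 * Real.pi)) hf.continuousOn
  refine MemLp.of_bound (hf.locallyIntegrable.integrableOn_isCompact
    isCompact_Icc).aestronglyMeasurable C ?_
  exact (ae_restrict_iff' measurableSet_Icc).2 (Filter.Eventually.of_forall hC)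

/-- An almost everywhere statement on one period that is periodic holds almost everywhere. -/
theorem ae_of_ae_periodMeasure {P : ℝ → Prop} (hP : ∀ x, P (x + 2 * Real.pi) ↔ P x)
    (h : ∀ᵐ x ∂periodMeasure, P x) : ∀ᵐ x, P x := by
  have hn : ∀ (n : ℤ) x, P (n • (2 * Real.pi) + x) ↔ P x := by
    intro n x
    have : Function.Periodic P (2 * Real.pi) := fun x => propext (hP x)
    rw [add_comm, this.zsmul n x]
  -- The exceptional set is invariant under translation by multiples of 2π and null on a fundamental
  -- domain.
  refine IsAddFundamentalDomain.measure_zero_of_invariant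
    (isAddFundamentalDomain_Ioc two_pi_pos 0) {x | ¬ P x} ?_ ?_
  · rintro ⟨g, n, rfl⟩
    ext x
    rw [mem_vadd_set_iff_neg_vadd_mem]
    simp only [mem_ofPred_eq, not_iff_not]
    have := hn (-n) x
    rw [neg_smul] at this
    exact this
  · rw [zero_add]
    have h1 : volume.restrict (Icc 0 (2 * Real.pi)) {x | ¬ P x} = 0 := h
    rw [Measure.restrict_apply₀'] at h1
    · exact measure_mono_null (inter_subset_inter_right _ Ioc_subset_Icc_self) h1
    · exact measurableSet_Icc.nullMeasurableSet

theorem integrable_inner_of_memLp {f g : ℝ → Plane} (hf : MemLp f 2 periodMeasure)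
    (hg : MemLp g 2 periodMeasure) : Integrable (fun x => inner ℝ (f x) (g x)) periodMeasure := by
  refine Integrable.mono' (hf.integrable_norm_pow'.add hg.integrable_norm_pow')
    (hf.1.inner hg.1) (Filter.Eventually.of_forall fun x => ?_)
  refine (norm_inner_le_norm _ _).trans ?_
  simp only [Pi.add_apply]
  nlinarith [sq_nonneg (‖f x‖ - ‖g x‖), sq_nonneg ‖f x‖, sq_nonneg ‖g x‖]

theorem eq_of_ae_eq_of_continuous {E : Type*} [NormedAddCommGroup E] {f g : ℝ → E}
    (hf : Continuous f) (hg : Continuous g) (h : f =ᵐ[volume] g) : f = g :=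
  (hf.ae_eq_iff_eq volume hg).1 h

/-! ### Periodic Sobolev functions -/

/-- The function `f` lies in `H¹_per` and `g` is its weak derivative. -/
structure HasH1Deriv (f g : ℝ → Plane) : Prop where
  periodic : Function.Periodic f (2 * Real.pi)
  periodic_deriv : Function.Periodic g (2 * Real.pi)
  isPrimitive : IsPrimitive f g
  memLp : MemLp g 2 periodMeasure

theorem HasH1Deriv.continuous {f g : ℝ → Plane} (h : HasH1Deriv f g) : Continuous f :=
  h.isPrimitive.continuous

theorem HasH1Deriv.integral_eq_zero {f g : ℝ → Plane} (h : HasH1Deriv f g) :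
    ∫ x in (0 : ℝ)..(2 * Real.pi), g x = 0 := by
  rw [h.isPrimitive.integral_eq, ← h.periodic 0, zero_add, sub_self]

theorem HasH1Deriv.memHPer {f g : ℝ → Plane} (h : HasH1Deriv f g) : MemHPer 1 f where
  periodic := h.periodic
  continuous := h.continuous
  weakDeriv := by
    refine ⟨fun j => if j = 0 then f else g, rfl, ?_, ?_⟩
    · intro j hj
      obtain rfl : j = 0 := by omega
      exact h.isPrimitive.isWeakDeriv
    · intro j hj
      by_cases h0 : j = 0
      · simpa [h0] using h.continuous.memLp_periodMeasure 2
      · simpa [h0] using h.memLp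

theorem HasH1Deriv.memHPer_two {F f g : ℝ → Plane} (h : HasH1Deriv f g)
    (hp : Function.Periodic F (2 * Real.pi)) (hF : IsPrimitive F f) : MemHPer 2 F where
  periodic := hp
  continuous := hF.continuous
  weakDeriv := by
    refine ⟨fun j => if j = 0 then F else if j = 1 then f else g, rfl, ?_, ?_⟩
    · intro j hj
      obtain rfl | rfl : j = 0 ∨ j = 1 := by omega
      · simpa using hF.isWeakDeriv
      · simpa using h.isPrimitive.isWeakDeriv
    · intro j hj
      obtain rfl | rfl | rfl : j = 0 ∨ j = 1 ∨ j = 2 := by omega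
      · simpa using hF.continuous.memLp_periodMeasure 2
      · simpa using h.continuous.memLp_periodMeasure 2
      · simpa using h.memLp

theorem hasH1Deriv_of_memLp {f g D : ℝ → Plane} (hp : Function.Periodic f (2 * Real.pi))
    (hP : IsPrimitive f D) (hD : MemLp D 2 periodMeasure) (hg : g = deriv f) :
    HasH1Deriv f g where
  periodic := hp
  periodic_deriv := by rw [hg]; exact SurfactantCurve.periodic_deriv hp
  isPrimitive := by rw [hg]; exact hP.congr_ae hP.ae_deriv_eq.symm
  memLp := by
    rw [hg]
    exact (memLp_congr_ae (ae_periodMeasure_of_ae hP.ae_deriv_eq)).2 hD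

theorem MemHPer.hasH1Deriv {f : ℝ → Plane} (h : MemHPer 1 f) : HasH1Deriv f (deriv f) := by
  obtain ⟨D, h0, h1, h2⟩ := h.weakDeriv
  obtain ⟨F, hF, hfF⟩ := (h1 0 one_pos).exists_isPrimitive
  rw [h0] at hfF
  obtain rfl := eq_of_ae_eq_of_continuous h.continuous hF.continuous hfF
  exact hasH1Deriv_of_memLp h.periodic hF (h2 1 le_rfl) rfl

/-- The first weak derivative is itself weakly differentiable, so it has a continuous representative
`G`; this makes `f` of class C¹ with derivative `G`. -/
theorem MemHPer.two_regularity {f : ℝ → Plane} (h : MemHPer 2 f) :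
    (∀ x, HasDerivAt f (deriv f x) x) ∧ HasH1Deriv (deriv f) (deriv (deriv f)) := by
  obtain ⟨D, h0, h1, h2⟩ := h.weakDeriv
  obtain ⟨F, hF, hfF⟩ := (h1 0 two_pos).exists_isPrimitive
  rw [h0] at hfF
  obtain rfl := eq_of_ae_eq_of_continuous h.continuous hF.continuous hfF
  obtain ⟨G, hG, hfG⟩ := (h1 1 one_lt_two).exists_isPrimitive
  have hd : ∀ x, HasDerivAt f (G x) x := hF.hasDerivAt hfG hG.continuous
  have hde : deriv f = G := funext fun x => (hd x).deriv
  refine ⟨fun x => by rw [hde]; exact hd x, ?_⟩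
  exact hasH1Deriv_of_memLp (SurfactantCurve.periodic_deriv h.periodic) (hde ▸ hG) (h2 2 le_rfl) rfl

theorem MemHPer.hasDerivAt {f : ℝ → Plane} (h : MemHPer 2 f) (x : ℝ) :
    HasDerivAt f (deriv f x) x := h.two_regularity.1 x

theorem MemHPer.hasH1Deriv_deriv {f : ℝ → Plane} (h : MemHPer 2 f) :
    HasH1Deriv (deriv f) (deriv (deriv f)) := h.two_regularity.2

theorem periodic_primitive {E : Type*} [NormedAddCommGroup E] [NormedSpace ℝ E] {f g : ℝ → E}
    (h : IsPrimitive f g)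
    (hg : Function.Periodic g (2 * Real.pi)) (h0 : ∫ x in (0 : ℝ)..(2 * Real.pi), g x = 0) :
    Function.Periodic f (2 * Real.pi) := by
  intro x
  have h1 := h.integral_eq x (x + 2 * Real.pi)
  rw [hg.intervalIntegral_add_eq x 0, zero_add, h0] at h1
  exact (sub_eq_zero.1 h1.symm)

/-- Every square integrable periodic function with mean zero is the weak derivative of a function
in `H¹_per` with mean zero. -/
theorem exists_hasH1Deriv {g : ℝ → Plane} (hp : Function.Periodic g (2 * Real.pi))
    (hg : MemLp g 2 periodMeasure) (h0 : ∫ x in (0 : ℝ)..(2 * Real.pi), g x = 0) :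
    ∃ f, HasH1Deriv f g ∧ ∫ x in (0 : ℝ)..(2 * Real.pi), f x = 0 := by
  have hl : LocallyIntegrable g volume := hp.locallyIntegrable (hg.integrable one_le_two)
  have h1 := IsPrimitive.of_integral hl 0
  -- Removing the mean lets the result have a periodic primitive in turn, as test functions for γ
  -- require.
  have h2 := h1.sub_const ((2 * Real.pi)⁻¹ • ∫ x in (0 : ℝ)..(2 * Real.pi), (0 + ∫ t in (0 : ℝ)..x, g t))
  refine ⟨_, ⟨periodic_primitive h2 hp h0, hp, h2, hg⟩, ?_⟩
  rw [intervalIntegral.integral_sub (h1.continuous.intervalIntegrable _ _)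
    (continuous_const.intervalIntegrable _ _), intervalIntegral.integral_const, sub_zero, smul_smul,
    mul_inv_cancel₀ two_pi_pos.ne', one_smul, sub_self]

/-- A periodic square integrable function which is orthogonal to all functions with mean zero is
constant. -/
theorem ae_eq_mean_of_orthogonal {u : ℝ → Plane} (hp : Function.Periodic u (2 * Real.pi))
    (hu : MemLp u 2 periodMeasure)
    (h : ∀ k : ℝ → Plane, Function.Periodic k (2 * Real.pi) → MemLp k 2 periodMeasure →
      ∫ x in (0 : ℝ)..(2 * Real.pi), k x = 0 →
        ∫ x in (0 : ℝ)..(2 * Real.pi), inner ℝ (u x) (k x) = 0) :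
    ∃ d : Plane, ∀ᵐ x, u x = d := by
  -- The test function is u − d with d the mean of u; being orthogonal both to u and to d, it has
  -- norm zero.
  set d : Plane := (2 * Real.pi)⁻¹ • ∫ x in (0 : ℝ)..(2 * Real.pi), u x with hd
  have hui : IntervalIntegrable u volume 0 (2 * Real.pi) :=
    integrable_periodMeasure_iff.1 (hu.integrable one_le_two)
  have hk : MemLp (fun x => u x - d) 2 periodMeasure := hu.sub (memLp_const d)
  have hk0 : ∫ x in (0 : ℝ)..(2 * Real.pi), (u x - d) = 0 := by
    rw [intervalIntegral.integral_sub hui (continuous_const.intervalIntegrable _ _),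
      intervalIntegral.integral_const, sub_zero, hd, smul_smul,
      mul_inv_cancel₀ two_pi_pos.ne', one_smul, sub_self]
  have hkp : Function.Periodic (fun x => u x - d) (2 * Real.pi) := fun x => by
    simp only [hp x]
  have h1 := h _ hkp hk hk0
  have h2 : ∫ x in (0 : ℝ)..(2 * Real.pi), inner ℝ d (u x - d) = 0 := by
    rw [← integral_periodMeasure, integral_inner (hk.integrable one_le_two),
      integral_periodMeasure, hk0, inner_zero_right]
  have h3 : ∫ x, ‖u x - d‖ ^ 2 ∂periodMeasure = 0 := by
    rw [integral_periodMeasure]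
    have : ∀ x, ‖u x - d‖ ^ 2 = inner ℝ (u x) (u x - d) - inner ℝ d (u x - d) := fun x => by
      rw [← inner_sub_left, real_inner_self_eq_norm_sq]
    simp_rw [this]
    rw [intervalIntegral.integral_sub, h1, h2, sub_zero]
    · exact integrable_periodMeasure_iff.1 (integrable_inner_of_memLp hu hk)
    · exact integrable_periodMeasure_iff.1 (integrable_inner_of_memLp (memLp_const d) hk)
  rw [integral_eq_zero_iff_of_nonneg (fun x => by positivity) hk.integrable_norm_pow'] at h3
  refine ⟨d, ae_of_ae_periodMeasure (fun x => by rw [hp x]) ?_⟩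
  filter_upwards [h3] with x hx
  have : ‖u x - d‖ = 0 := by simpa using hx
  exact sub_eq_zero.1 (norm_eq_zero.1 this)

/-! ### The rotation by π/2 -/

section Rotation

@[simp] theorem rot_zero_apply (v : Plane) : rot v 0 = -(v 1) := by simp [rot]

@[simp] theorem rot_one_apply (v : Plane) : rot v 1 = v 0 := by simp [rot]

theorem plane_inner (u v : Plane) : inner ℝ u v = u 0 * v 0 + u 1 * v 1 := by
  simp [PiLp.inner_apply, Fin.sum_univ_two]; ring

theorem plane_norm_sq (u : Plane) : ‖u‖ ^ 2 = u 0 ^ 2 + u 1 ^ 2 := by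
  rw [← real_inner_self_eq_norm_sq, plane_inner]; ring

theorem plane_ext {u v : Plane} (h0 : u 0 = v 0) (h1 : u 1 = v 1) : u = v := by
  ext i; fin_cases i <;> assumption

theorem norm_rot (v : Plane) : ‖rot v‖ = ‖v‖ := by
  rw [← sq_eq_sq₀ (norm_nonneg _) (norm_nonneg _), plane_norm_sq, plane_norm_sq]
  simp; ring

/-- The rotation by `π/2` as a continuous linear map. -/
noncomputable def rotL : Plane →L[ℝ] Plane :=
  LinearMap.toContinuousLinearMap
    { toFun := rot
      map_add' := fun u v => plane_ext (by simp; ring) (by simp)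
      map_smul' := fun a v => plane_ext (by simp) (by simp) }

@[simp] theorem rotL_apply (v : Plane) : rotL v = rot v := rfl

theorem rot_add (u v : Plane) : rot (u + v) = rot u + rot v := rotL.map_add u v

theorem rot_smul (a : ℝ) (v : Plane) : rot (a • v) = a • rot v := rotL.map_smul a v

theorem inner_rot_self (v : Plane) : inner ℝ v (rot v) = 0 := by
  rw [plane_inner]; simp; ring

theorem inner_rot_rot (u v : Plane) : inner ℝ (rot u) (rot v) = inner ℝ u v := by
  rw [plane_inner, plane_inner]; simp; ring

theorem inner_rot_left (u v : Plane) : inner ℝ (rot u) v = -inner ℝ u (rot v) := by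
  rw [plane_inner, plane_inner]; simp

end Rotation

/-! ### Geometric quantities in terms of x-derivatives -/

section Geometry

/-- The derivative of |∂ₓγ|⁻¹ need not be computed: it multiplies ∂ₓγ, which is orthogonal to the
normal. -/
theorem curvature_eq {γ : ℝ → Plane} {M : Plane} {x : ℝ} (h0 : deriv γ x ≠ 0)
    (h : HasDerivAt (deriv γ) M x) :
    curvature γ x = inner ℝ M (rot (deriv γ x)) * ‖deriv γ x‖⁻¹ ^ 3 := by
  have hn : HasDerivAt (fun y => ‖deriv γ y‖⁻¹) (deriv (fun y => ‖deriv γ y‖⁻¹) x) x :=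
    ((h.differentiableAt.norm ℝ h0).inv (norm_ne_zero_iff.2 h0)).hasDerivAt
  have ht : deriv (tangent γ) x = ‖deriv γ x‖⁻¹ • M +
      (deriv (fun y => ‖deriv γ y‖⁻¹) x) • deriv γ x := (hn.smul h).deriv
  rw [curvature, arcDeriv, ht, normal, tangent, arcDeriv, rot_smul]
  simp only [inner_smul_left, inner_smul_right, inner_add_left, inner_rot_self]
  simp
  ring

theorem curveDiv_eq (γ η : ℝ → Plane) (x : ℝ) :
    curveDiv γ η x = inner ℝ (deriv η x) (deriv γ x) * ‖deriv γ x‖⁻¹ ^ 2 := by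
  simp [curveDiv, tangent, arcDeriv, inner_smul_left, inner_smul_right]
  ring

theorem matrixNormSq_curveGrad {γ : ℝ → Plane} (η : ℝ → Plane) {x : ℝ} (h0 : deriv γ x ≠ 0) :
    matrixNormSq (curveGrad γ η x) = ‖deriv η x‖ ^ 2 * ‖deriv γ x‖⁻¹ ^ 2 := by
  have h1 : ‖tangent γ x‖ ^ 2 = 1 := by
    rw [tangent, arcDeriv, norm_smul, norm_inv, norm_norm,
      inv_mul_cancel₀ (norm_ne_zero_iff.2 h0), one_pow]
  have h2 : ‖arcDeriv γ η x‖ ^ 2 = ‖deriv η x‖ ^ 2 * ‖deriv γ x‖⁻¹ ^ 2 := by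
    rw [arcDeriv, norm_smul, norm_inv, norm_norm]; ring
  have h3 : matrixNormSq (curveGrad γ η x) = ‖arcDeriv γ η x‖ ^ 2 * ‖tangent γ x‖ ^ 2 := by
    rw [plane_norm_sq, plane_norm_sq]
    simp [matrixNormSq, curveGrad, Fin.sum_univ_two]
    ring
  rw [h3, h1, h2, mul_one]

end Geometry

/-! ### Differentiation under the integral for dominated Lipschitz families -/

section Families

/-- A one-parameter family of functions which, for small parameters, is bounded by a multiple of
`b` and is Lipschitz in the parameter with a constant that is a multiple of `b`. -/
def IsLipFamily {E : Type*} [NormedAddCommGroup E] (b : ℝ → ℝ) (f : ℝ → ℝ → E) : Prop :=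
  ∃ s > 0, ∃ K ≥ 0, ∀ ε, |ε| < s → ∀ ε', |ε'| < s → ∀ x,
    ‖f ε x‖ ≤ K * b x ∧ ‖f ε x - f ε' x‖ ≤ K * b x * |ε - ε'|

variable {E : Type*} [NormedAddCommGroup E] {b b' : ℝ → ℝ}

theorem IsLipFamily.of_eventually_le {E' : Type*} [NormedAddCommGroup E'] {f : ℝ → ℝ → E}
    {g : ℝ → ℝ → E'} (hf : IsLipFamily b f) {C s : ℝ} (hC : 0 ≤ C) (hs : 0 < s)
    (h1 : ∀ ε, |ε| < s → ∀ x, ‖g ε x‖ ≤ C * ‖f ε x‖)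
    (h2 : ∀ ε, |ε| < s → ∀ ε', |ε'| < s → ∀ x, ‖g ε x - g ε' x‖ ≤ C * ‖f ε x - f ε' x‖) :
    IsLipFamily b g := by
  obtain ⟨t, ht, K, hK, h⟩ := hf
  refine ⟨min s t, lt_min hs ht, C * K, by positivity, fun ε hε ε' hε' x => ?_⟩
  rw [lt_min_iff] at hε hε'
  obtain ⟨a1, a2⟩ := h ε hε.2 ε' hε'.2 x
  refine ⟨(h1 ε hε.1 x).trans ?_, (h2 ε hε.1 ε' hε'.1 x).trans ?_⟩
  · rw [mul_assoc]; gcongr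
  · rw [mul_assoc, mul_assoc, ← mul_assoc K]; gcongr

theorem isLipFamily_affine [NormedSpace ℝ E] {u v : ℝ → E} {K : ℝ} (hK : 0 ≤ K)
    (hu : ∀ x, ‖u x‖ ≤ K * b x) (hv : ∀ x, ‖v x‖ ≤ K * b x) :
    IsLipFamily b (fun ε x => u x + ε • v x) := by
  refine ⟨1, one_pos, 2 * K, by positivity, fun ε hε ε' _ x => ⟨?_, ?_⟩⟩
  · have h1 : |ε| * ‖v x‖ ≤ 1 * (K * b x) :=
      mul_le_mul hε.le (hv x) (norm_nonneg _) zero_le_one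
    calc ‖u x + ε • v x‖ ≤ ‖u x‖ + |ε| * ‖v x‖ := by
          refine (norm_add_le _ _).trans ?_
          rw [norm_smul, Real.norm_eq_abs]
      _ ≤ 2 * K * b x := by linarith [hu x]
  · have h0 : 0 ≤ K * b x := (norm_nonneg _).trans (hv x)
    rw [add_sub_add_left_eq_sub, ← sub_smul, norm_smul, Real.norm_eq_abs, mul_comm]
    refine mul_le_mul_of_nonneg_right ?_ (abs_nonneg _)
    linarith [hv x]

theorem IsLipFamily.add {f g : ℝ → ℝ → E} (hf : IsLipFamily b f) (hg : IsLipFamily b g) :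
    IsLipFamily b (fun ε x => f ε x + g ε x) := by
  obtain ⟨s, hs, K, hK, h⟩ := hf
  obtain ⟨t, ht, L, hL, h'⟩ := hg
  refine ⟨min s t, lt_min hs ht, K + L, by positivity, fun ε hε ε' hε' x => ?_⟩
  rw [lt_min_iff] at hε hε'
  obtain ⟨a1, a2⟩ := h ε hε.1 ε' hε'.1 x
  obtain ⟨b1, b2⟩ := h' ε hε.2 ε' hε'.2 x
  constructor
  · refine (norm_add_le _ _).trans ?_
    linarith
  · rw [add_sub_add_comm]
    refine (norm_add_le _ _).trans ?_
    linarith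

theorem IsLipFamily.inner [InnerProductSpace ℝ E] {f g : ℝ → ℝ → E} (hf : IsLipFamily b f)
    (hg : IsLipFamily b' g) :
    IsLipFamily (fun x => b x * b' x) (fun ε x => inner ℝ (f ε x) (g ε x)) := by
  obtain ⟨s, hs, K, hK, h⟩ := hf
  obtain ⟨t, ht, L, hL, h'⟩ := hg
  -- The factor 2 comes from splitting the difference of products into two terms, each with
  -- Lipschitz constant K * L.
  refine ⟨min s t, lt_min hs ht, 2 * (K * L), by positivity, fun ε hε ε' hε' x => ?_⟩
  rw [lt_min_iff] at hε hε'
  obtain ⟨a1, a2⟩ := h ε hε.1 ε' hε'.1 x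
  obtain ⟨b1, b2⟩ := h' ε hε.2 ε' hε'.2 x
  obtain ⟨b3, -⟩ := h' ε' hε'.2 ε hε.2 x
  have hKb : 0 ≤ K * b x := (norm_nonneg _).trans a1
  have hLb : 0 ≤ L * b' x := (norm_nonneg _).trans b1
  constructor
  · refine (norm_inner_le_norm _ _).trans ?_
    have := mul_le_mul a1 b1 (norm_nonneg _) hKb
    nlinarith [mul_nonneg hKb hLb]
  · have : Inner.inner ℝ (f ε x) (g ε x) - Inner.inner ℝ (f ε' x) (g ε' x) =
        Inner.inner ℝ (f ε x) (g ε x - g ε' x) + Inner.inner ℝ (f ε x - f ε' x) (g ε' x) := by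
      rw [inner_sub_right, inner_sub_left]; ring
    rw [this]
    refine (norm_add_le _ _).trans ?_
    have e1 := (norm_inner_le_norm (𝕜 := ℝ) (f ε x) (g ε x - g ε' x)).trans
      (mul_le_mul a1 b2 (norm_nonneg _) hKb)
    have e2 := (norm_inner_le_norm (𝕜 := ℝ) (f ε x - f ε' x) (g ε' x)).trans
      (mul_le_mul a2 b3 (norm_nonneg _) (mul_nonneg hKb (abs_nonneg _)))
    calc _ ≤ _ := add_le_add e1 e2
      _ = _ := by ring

theorem IsLipFamily.mul {f g : ℝ → ℝ → ℝ} (hf : IsLipFamily b f) (hg : IsLipFamily b' g) :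
    IsLipFamily (fun x => b x * b' x) (fun ε x => f ε x * g ε x) := by
  have := hg.inner hf
  simpa [mul_comm] using this

theorem IsLipFamily.const_mul {f : ℝ → ℝ → ℝ} (hf : IsLipFamily b f) (a : ℝ) :
    IsLipFamily b (fun ε x => a * f ε x) := by
  refine hf.of_eventually_le (abs_nonneg a) one_pos (fun ε _ x => ?_) fun ε _ ε' _ x => ?_
  · rw [norm_mul, Real.norm_eq_abs a]
  · rw [← mul_sub, norm_mul, Real.norm_eq_abs a]

theorem IsLipFamily.norm {f : ℝ → ℝ → E} (hf : IsLipFamily b f) :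
    IsLipFamily b (fun ε x => ‖f ε x‖) := by
  refine hf.of_eventually_le zero_le_one one_pos (fun ε _ x => ?_) fun ε _ ε' _ x => ?_
  · rw [one_mul, norm_norm]
  · rw [one_mul]; exact abs_norm_sub_norm_le _ _

theorem IsLipFamily.inv {f : ℝ → ℝ → ℝ} (hf : IsLipFamily (fun _ => 1) f) {c s : ℝ} (hc : 0 < c)
    (hs : 0 < s) (h : ∀ ε, |ε| < s → ∀ x, c ≤ f ε x) :
    IsLipFamily (fun _ => 1) (fun ε x => (f ε x)⁻¹) := by
  obtain ⟨t, ht, K, hK, h'⟩ := hf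
  -- The first summand bounds the values, the second the difference quotients.
  refine ⟨min s t, lt_min hs ht, c⁻¹ + K * c⁻¹ * c⁻¹, by positivity, fun ε hε ε' hε' x => ?_⟩
  rw [lt_min_iff] at hε hε'
  obtain ⟨-, a2⟩ := h' ε hε.2 ε' hε'.2 x
  have h1 := h ε hε.1 x
  have h2 := h ε' hε'.1 x
  have p1 := hc.trans_le h1
  have p2 := hc.trans_le h2
  have i1 : (f ε x)⁻¹ ≤ c⁻¹ := inv_anti₀ hc h1
  have i2 : (f ε' x)⁻¹ ≤ c⁻¹ := inv_anti₀ hc h2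
  have q1 : 0 ≤ (f ε x)⁻¹ := by positivity
  have q2 : 0 ≤ (f ε' x)⁻¹ := by positivity
  constructor
  · rw [Real.norm_eq_abs, abs_of_nonneg q1]
    have : 0 ≤ K * c⁻¹ * c⁻¹ := by positivity
    linarith
  · have e : (f ε x)⁻¹ - (f ε' x)⁻¹ = -(f ε x - f ε' x) * ((f ε x)⁻¹ * (f ε' x)⁻¹) := by
      field_simp; ring
    rw [e, norm_mul, norm_neg, norm_mul, Real.norm_of_nonneg q1, Real.norm_of_nonneg q2]
    have e2 : (f ε x)⁻¹ * (f ε' x)⁻¹ ≤ c⁻¹ * c⁻¹ := mul_le_mul i1 i2 q2 (by positivity)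
    have e3 : 0 ≤ c⁻¹ * |ε - ε'| := by positivity
    calc _ ≤ (K * 1 * |ε - ε'|) * (c⁻¹ * c⁻¹) :=
          mul_le_mul a2 e2 (by positivity) (by positivity)
      _ ≤ _ := by linarith

theorem IsLipFamily.integrable {f : ℝ → ℝ → ℝ} (hf : IsLipFamily b f)
    (hb : Integrable b periodMeasure) (hm : ∀ ε, Measurable (f ε)) :
    ∃ s > 0, ∀ ε, |ε| < s → Integrable (f ε) periodMeasure := by
  obtain ⟨s, hs, K, hK, h⟩ := hf
  exact ⟨s, hs, fun ε hε => Integrable.mono' (hb.const_mul K) (hm ε).aestronglyMeasurable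
    (Filter.Eventually.of_forall fun x => (h ε hε ε hε x).1)⟩

theorem IsLipFamily.hasDerivAt_integral {f : ℝ → ℝ → ℝ} (hf : IsLipFamily b f)
    (hb : Integrable b periodMeasure) (hm : ∀ ε, Measurable (f ε)) {f' : ℝ → ℝ}
    (hf' : Measurable f') (hd : ∀ x, HasDerivAt (fun ε => f ε x) (f' x) 0) :
    Integrable f' periodMeasure ∧
      HasDerivAt (fun ε => ∫ x, f ε x ∂periodMeasure) (∫ x, f' x ∂periodMeasure) 0 := by
  obtain ⟨t, ht, hint⟩ := hf.integrable hb hm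
  obtain ⟨s, hs, K, hK, h⟩ := hf
  refine hasDerivAt_integral_of_dominated_loc_of_lip (bound := fun x => K * b x)
    (Metric.ball_mem_nhds (0 : ℝ) hs) (Filter.Eventually.of_forall fun ε =>
      (hm ε).aestronglyMeasurable) (hint 0 (by simpa using ht)) hf'.aestronglyMeasurable
    (Filter.Eventually.of_forall fun x => ?_) (hb.const_mul K) (Filter.Eventually.of_forall hd)
  refine LipschitzOnWith.of_dist_le_mul fun ε hε ε' hε' => ?_
  rw [Metric.mem_ball, dist_zero_right, Real.norm_eq_abs] at hε hε'
  obtain ⟨h1, h2⟩ := h ε hε ε' hε' x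
  rw [dist_eq_norm, Real.dist_eq, Real.coe_nnabs, abs_of_nonneg ((norm_nonneg _).trans h1)]
  exact h2

end Families

/-! ### The energy density and its partial gradients -/

/-- The energy density in terms of `P = ∂_x γ`, `M = ∂_x² γ` and `H = ∂_x η`. -/
noncomputable def energyDensity (δ lam : ℝ) (P M H : Plane) : ℝ :=
  1 / 2 * ((inner ℝ M (rot P) * ‖P‖⁻¹ ^ 3 + δ * (inner ℝ H P * ‖P‖⁻¹ ^ 2)) ^ 2 * ‖P‖)
    + lam / 2 * (‖H‖ ^ 2 * ‖P‖⁻¹ ^ 2 * ‖P‖) + ‖P‖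

/-- The quantity `κ + δ div_γ η` where `|∂_x γ| = c`. -/
noncomputable def coupledCurvature (δ c : ℝ) (p m h : Plane) : ℝ :=
  inner ℝ m (rot p) / c ^ 3 + δ * inner ℝ h p / c ^ 2

/-- The derivative of the energy density with respect to `∂_x² γ`. -/
noncomputable def densityDerivM (δ c : ℝ) (p m h : Plane) : Plane :=
  (coupledCurvature δ c p m h / c ^ 2) • rot p

/-- The derivative of the energy density with respect to `∂_x η`. -/
noncomputable def densityDerivH (δ lam c : ℝ) (p m h : Plane) : Plane :=
  (δ * coupledCurvature δ c p m h / c) • p + (lam / c) • h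

/-- The derivative of the energy density with respect to `∂_x γ`. -/
noncomputable def densityDerivP (δ lam c : ℝ) (p m h : Plane) : Plane :=
  (coupledCurvature δ c p m h * c) • (-(1 / c ^ 3) • rot m + (δ / c ^ 2) • h
      - (3 * inner ℝ m (rot p) / c ^ 5 + 2 * δ * inner ℝ h p / c ^ 4) • p)
    + (coupledCurvature δ c p m h ^ 2 / (2 * c) - lam * ‖h‖ ^ 2 / (2 * c ^ 3) + 1 / c) • p

theorem hasDerivAt_energyDensity (δ lam : ℝ) {c : ℝ} (hc : 0 < c) {p : Plane} (hp : ‖p‖ = c)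
    (m h q r k : Plane) :
    HasDerivAt (fun ε : ℝ => energyDensity δ lam (p + ε • q) (m + ε • r) (h + ε • k))
      (inner ℝ (densityDerivM δ c p m h) r + inner ℝ (densityDerivP δ lam c p m h) q
        + inner ℝ (densityDerivH δ lam c p m h) k) 0 := by
  have hl : ∀ u v : Plane, HasDerivAt (fun ε : ℝ => u + ε • v) v 0 := fun u v => by
    simpa using ((hasDerivAt_id (0 : ℝ)).smul_const v).const_add u
  have hρsq : HasDerivAt (fun ε : ℝ => ‖p + ε • q‖ ^ 2) (2 * inner ℝ p q) 0 := by
    simpa using (hl p q).norm_sq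
  -- The norm is differentiated as the square root of its square, which is positive at ε = 0.
  have hρ : HasDerivAt (fun ε : ℝ => ‖p + ε • q‖) (inner ℝ p q / c) 0 := by
    have h1 := hρsq.sqrt (by simp [hp, hc.ne'])
    simp only [Real.sqrt_sq (norm_nonneg _), zero_smul, add_zero, hp, Real.sqrt_sq hc.le] at h1
    convert! h1 using 1
    field_simp
  have hρi : HasDerivAt (fun ε : ℝ => ‖p + ε • q‖⁻¹) (-(inner ℝ p q / c) / c ^ 2) 0 := by
    have := hρ.fun_inv (by simp [hp, hc.ne'])
    simpa [hp] using this
  have hN : HasDerivAt (fun ε : ℝ => inner ℝ (m + ε • r) (rot (p + ε • q)))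
      (inner ℝ m (rot q) + inner ℝ r (rot p)) 0 := by
    have h1 : HasDerivAt (fun ε : ℝ => rot (p + ε • q)) (rot q) 0 := by
      simpa [rot_add, rot_smul] using hl (rot p) (rot q)
    simpa using (hl m r).inner ℝ h1
  have hH : HasDerivAt (fun ε : ℝ => inner ℝ (h + ε • k) (p + ε • q))
      (inner ℝ h q + inner ℝ k p) 0 := by
    simpa using (hl h k).inner ℝ (hl p q)
  have hh : HasDerivAt (fun ε : ℝ => ‖h + ε • k‖ ^ 2) (2 * inner ℝ h k) 0 := by
    simpa using (hl h k).norm_sq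
  have := (((((hN.mul (hρi.pow 3)).add ((hH.mul (hρi.pow 2)).const_mul δ)).pow 2).mul hρ).const_mul
    (1 / 2)).add (((hh.mul (hρi.pow 2)).mul hρ).const_mul (lam / 2)) |>.add hρ
  refine HasDerivAt.congr_deriv this ?_
  simp only [zero_smul, add_zero, hp, Pi.mul_apply, Pi.pow_apply, Pi.add_apply, Nat.reduceSub,
    pow_one, Nat.cast_ofNat, inv_pow]
  have e1 : inner ℝ (densityDerivM δ c p m h) r
      = coupledCurvature δ c p m h / c ^ 2 * inner ℝ r (rot p) := by
    rw [densityDerivM, inner_smul_left, real_inner_comm]; simp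
  have e2 : inner ℝ (densityDerivP δ lam c p m h) q =
      (coupledCurvature δ c p m h * c) * (inner ℝ m (rot q) / c ^ 3 + δ / c ^ 2 * inner ℝ h q
      - (3 * inner ℝ m (rot p) / c ^ 5 + 2 * δ * inner ℝ h p / c ^ 4) * inner ℝ p q)
      + (coupledCurvature δ c p m h ^ 2 / (2 * c) - lam * ‖h‖ ^ 2 / (2 * c ^ 3) + 1 / c)
        * inner ℝ p q := by
    simp only [densityDerivP, inner_add_left, inner_smul_left, inner_sub_left, inner_rot_left]
    simp
    left
    ring
  have e3 : inner ℝ (densityDerivH δ lam c p m h) k =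
      δ * coupledCurvature δ c p m h / c * inner ℝ k p + lam / c * inner ℝ h k := by
    simp only [densityDerivH, inner_add_left, inner_smul_left, real_inner_comm k p]
    simp
  rw [e1, e2, e3, coupledCurvature]
  field_simp
  ring

/-! ### The first variation -/

theorem exists_bound_of_periodic {f : ℝ → Plane} (hf : Continuous f)
    (hp : Function.Periodic f (2 * Real.pi)) : ∃ C ≥ 0, ∀ x, ‖f x‖ ≤ C := by
  obtain ⟨C, hC⟩ := isCompact_Icc.exists_bound_of_continuousOn
    (f := f) (s := Icc 0 (2 * Real.pi)) hf.continuousOn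
  have h0 := (norm_nonneg _).trans (hC 0 ⟨le_rfl, two_pi_pos.le⟩)
  refine ⟨C, h0, fun x => ?_⟩
  obtain ⟨y, hy, hxy⟩ := hp.exists_mem_Ico₀ two_pi_pos x
  rw [hxy]
  exact hC y ⟨hy.1, hy.2.le⟩

/-- The integrability hypotheses allow the integral of the density to be split into the three terms
of the energy. -/
theorem energyLM_eq {δ lam : ℝ} {γ η : ℝ → Plane} (h0 : ∀ x, deriv γ x ≠ 0)
    (hγ : ∀ᵐ x, HasDerivAt (deriv γ) (deriv (deriv γ) x) x)
    (h1 : Integrable (fun x => (inner ℝ (deriv (deriv γ) x) (rot (deriv γ x)) * ‖deriv γ x‖⁻¹ ^ 3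
      + δ * (inner ℝ (deriv η x) (deriv γ x) * ‖deriv γ x‖⁻¹ ^ 2)) ^ 2 * ‖deriv γ x‖) periodMeasure)
    (h2 : Integrable (fun x => ‖deriv η x‖ ^ 2 * ‖deriv γ x‖⁻¹ ^ 2 * ‖deriv γ x‖) periodMeasure)
    (h3 : Integrable (fun x => ‖deriv γ x‖) periodMeasure) :
    energyLM δ lam γ η =
      ∫ x, energyDensity δ lam (deriv γ x) (deriv (deriv γ) x) (deriv η x) ∂periodMeasure := by
  simp only [energyDensity]
  have e1 := integral_add ((h1.const_mul (1 / 2)).add (h2.const_mul (lam / 2))) h3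
  have e2 := integral_add (h1.const_mul (1 / 2)) (h2.const_mul (lam / 2))
  simp only [Pi.add_apply] at e1 e2
  rw [e1, e2, integral_const_mul, integral_const_mul,
    energyLM, curveIntegral, curveIntegral, curveLength, ← integral_periodMeasure,
    ← integral_periodMeasure, ← integral_periodMeasure]
  congr 3
  · refine integral_congr_ae (ae_periodMeasure_of_ae ?_)
    filter_upwards [hγ] with x hx
    rw [curvature_eq (h0 x) hx, curveDiv_eq]
  · refine integral_congr_ae (Filter.Eventually.of_forall fun x => ?_)
    simp only [matrixNormSq_curveGrad η (h0 x)]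

theorem measurable_rot : Measurable rot := rotL.continuous.measurable

section Measurability

variable {P M H Q R K : ℝ → Plane}

theorem measurable_bendingDensity (hP : Measurable P) (hM : Measurable M) (hH : Measurable H)
    (δ : ℝ) : Measurable (fun x => (inner ℝ (M x) (rot (P x)) * ‖P x‖⁻¹ ^ 3
      + δ * (inner ℝ (H x) (P x) * ‖P x‖⁻¹ ^ 2)) ^ 2 * ‖P x‖) :=
  ((((hM.inner (measurable_rot.comp hP)).mul (hP.norm.inv.pow_const 3)).add
    (((hH.inner hP).mul (hP.norm.inv.pow_const 2)).const_mul δ)).pow_const 2).mul hP.norm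

theorem measurable_gradDensity (hP : Measurable P) (hH : Measurable H) :
    Measurable (fun x => ‖H x‖ ^ 2 * ‖P x‖⁻¹ ^ 2 * ‖P x‖) :=
  ((hH.norm.pow_const 2).mul (hP.norm.inv.pow_const 2)).mul hP.norm

theorem measurable_energyDensity (hP : Measurable P) (hM : Measurable M) (hH : Measurable H)
    (δ lam : ℝ) : Measurable (fun x => energyDensity δ lam (P x) (M x) (H x)) :=
  (((measurable_bendingDensity hP hM hH δ).const_mul _).add
    ((measurable_gradDensity hP hH).const_mul _)).add hP.norm

theorem measurable_coupledCurvature (hP : Measurable P) (hM : Measurable M) (hH : Measurable H)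
    (δ c : ℝ) : Measurable (fun x => coupledCurvature δ c (P x) (M x) (H x)) :=
  ((hM.inner (measurable_rot.comp hP)).div_const _).add (((hH.inner hP).const_mul δ).div_const _)

theorem measurable_densityDerivM (hP : Measurable P) (hM : Measurable M) (hH : Measurable H)
    (δ c : ℝ) : Measurable (fun x => densityDerivM δ c (P x) (M x) (H x)) :=
  ((measurable_coupledCurvature hP hM hH δ c).div_const _).smul (measurable_rot.comp hP)

theorem measurable_densityDerivH (hP : Measurable P) (hM : Measurable M) (hH : Measurable H)
    (δ lam c : ℝ) : Measurable (fun x => densityDerivH δ lam c (P x) (M x) (H x)) := by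
  have h1 := (((measurable_coupledCurvature hP hM hH δ c).const_mul δ).div_const c).smul hP
  have h2 : Measurable (fun x => (lam / c) • H x) := hH.const_smul (lam / c)
  exact h1.add h2

theorem measurable_densityDerivP (hP : Measurable P) (hM : Measurable M) (hH : Measurable H)
    (δ lam c : ℝ) : Measurable (fun x => densityDerivP δ lam c (P x) (M x) (H x)) := by
  have mc := measurable_coupledCurvature hP hM hH δ c
  have h1 : Measurable (fun x => -(1 / c ^ 3) • rot (M x)) :=
    (measurable_rot.comp hM).const_smul (-(1 / c ^ 3))
  have h2 : Measurable (fun x => (δ / c ^ 2) • H x) := hH.const_smul (δ / c ^ 2)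
  have h3 : Measurable (fun x => 3 * inner ℝ (M x) (rot (P x)) / c ^ 5
      + 2 * δ * inner ℝ (H x) (P x) / c ^ 4) :=
    (((hM.inner (measurable_rot.comp hP)).const_mul _).div_const _).add
      (((hH.inner hP).const_mul _).div_const _)
  have h4 : Measurable (fun x => coupledCurvature δ c (P x) (M x) (H x) ^ 2 / (2 * c)
      - lam * ‖H x‖ ^ 2 / (2 * c ^ 3) + 1 / c) :=
    (((mc.pow_const 2).div_const _).sub
      (((hH.norm.pow_const 2).const_mul _).div_const _)).add_const _
  exact ((mc.mul_const c).smul ((h1.add h2).sub (h3.smul hP))).add (h4.smul hP)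

end Measurability

/-- The first variation of the energy at a curve parametrized proportionally to arc length. -/
theorem IsCriticalPoint.firstVariation {δ lam c : ℝ} {γ η φ ψ : ℝ → Plane} (hγ : MemHPer 2 γ)
    (hη : MemHPer 1 η) (hc : 0 < c) (hγc : ∀ x, ‖deriv γ x‖ = c)
    (hcrit : IsCriticalPoint δ lam γ η) (hφ : MemHPer 2 φ) (hψ : MemHPer 1 ψ) :
    ∫ x, (inner ℝ (densityDerivM δ c (deriv γ x) (deriv (deriv γ) x) (deriv η x))
          (deriv (deriv φ) x)
        + inner ℝ (densityDerivP δ lam c (deriv γ x) (deriv (deriv γ) x) (deriv η x)) (deriv φ x)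
        + inner ℝ (densityDerivH δ lam c (deriv γ x) (deriv (deriv γ) x) (deriv η x)) (deriv ψ x))
      ∂periodMeasure = 0 := by
  have hp := hγ.hasH1Deriv_deriv
  have hq := hφ.hasH1Deriv_deriv
  have hh := hη.hasH1Deriv
  have hk := hψ.hasH1Deriv
  set p := deriv γ with hpdef
  set m := deriv p with hmdef
  set h := deriv η with hhdef
  set q := deriv φ with hqdef
  set r := deriv q with hrdef
  set k := deriv ψ with hkdef
  obtain ⟨Q, hQ0, hQ⟩ := exists_bound_of_periodic hq.continuous hq.periodic
  have mp : Measurable p := measurable_deriv _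
  have mm : Measurable m := measurable_deriv _
  have mh : Measurable h := measurable_deriv _
  have mq : Measurable q := measurable_deriv _
  have mr : Measurable r := measurable_deriv _
  have mk : Measurable k := measurable_deriv _
  -- A common L² dominator. The density grows quadratically in m and h, so v² dominates it; the
  -- summand 1 gives v ≥ 1 and covers the length term.
  set v : ℝ → ℝ := fun x => 1 + ‖m x‖ + ‖r x‖ + ‖h x‖ + ‖k x‖ with hv
  have hvm : MemLp v 2 periodMeasure :=
    ((((memLp_const (1 : ℝ)).add hp.memLp.norm).add hq.memLp.norm).add hh.memLp.norm).add
      hk.memLp.norm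
  have hv2 : Integrable (fun x => v x * v x) periodMeasure := by
    simpa [pow_two] using hvm.integrable_sq
  have hv1 : Integrable (fun _ : ℝ => (1 : ℝ)) periodMeasure := integrable_const _
  have fP : IsLipFamily (fun _ => 1) (fun ε x => p x + ε • q x) :=
    isLipFamily_affine (K := c + Q) (by positivity) (fun x => by rw [hγc x]; linarith)
      (fun x => by linarith [hQ x])
  have fJP : IsLipFamily (fun _ => 1) (fun ε x => rot (p x + ε • q x)) := by
    refine fP.of_eventually_le zero_le_one one_pos (fun ε _ x => ?_) fun ε _ ε' _ x => ?_
    · rw [norm_rot, one_mul]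
    · rw [one_mul, ← norm_rot (p x + ε • q x - _), ← rotL_apply, ← rotL_apply, ← rotL_apply,
        map_sub]
  have fM : IsLipFamily v (fun ε x => m x + ε • r x) :=
    isLipFamily_affine (K := 1) zero_le_one
      (fun x => by
        simp only [hv]
        linarith [norm_nonneg (m x), norm_nonneg (r x), norm_nonneg (h x), norm_nonneg (k x)])
      (fun x => by
        simp only [hv]
        linarith [norm_nonneg (m x), norm_nonneg (r x), norm_nonneg (h x), norm_nonneg (k x)])
  have fH : IsLipFamily v (fun ε x => h x + ε • k x) :=
    isLipFamily_affine (K := 1) zero_le_one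
      (fun x => by
        simp only [hv]
        linarith [norm_nonneg (m x), norm_nonneg (r x), norm_nonneg (h x), norm_nonneg (k x)])
      (fun x => by
        simp only [hv]
        linarith [norm_nonneg (m x), norm_nonneg (r x), norm_nonneg (h x), norm_nonneg (k x)])
  -- For such ε the perturbed speed stays above c / 2, so its inverse powers are uniformly Lipschitz
  -- in ε. Using Q + 1 avoids dividing by zero.
  have hs : 0 < c / (2 * (Q + 1)) := by positivity
  have hlow : ∀ ε, |ε| < c / (2 * (Q + 1)) → ∀ x, c / 2 ≤ ‖p x + ε • q x‖ := by
    intro ε hε x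
    have h1 : ‖ε • q x‖ ≤ c / (2 * (Q + 1)) * (Q + 1) := by
      rw [norm_smul, Real.norm_eq_abs]
      exact mul_le_mul hε.le (by linarith [hQ x]) (norm_nonneg _) hs.le
    have h2 : c / (2 * (Q + 1)) * (Q + 1) = c / 2 := by field_simp
    have h3 := norm_sub_le_norm_add (p x) (ε • q x)
    rw [hγc x] at h3
    linarith
  have fi := fP.norm.inv (half_pos hc) hs hlow
  have fi2 : IsLipFamily (fun _ => 1) (fun ε x => ‖p x + ε • q x‖⁻¹ ^ 2) := by
    simpa only [mul_one, pow_two] using fi.mul fi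
  have fi3 : IsLipFamily (fun _ => 1) (fun ε x => ‖p x + ε • q x‖⁻¹ ^ 3) := by
    simpa only [mul_one, pow_succ, pow_zero, one_mul] using (fi.mul fi).mul fi
  have fN : IsLipFamily v (fun ε x => inner ℝ (m x + ε • r x) (rot (p x + ε • q x))
      * ‖p x + ε • q x‖⁻¹ ^ 3 + δ * (inner ℝ (h x + ε • k x) (p x + ε • q x)
      * ‖p x + ε • q x‖⁻¹ ^ 2)) := by
    refine IsLipFamily.add ?_ (IsLipFamily.const_mul ?_ δ)
    · simpa only [mul_one] using (fM.inner fJP).mul fi3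
    · simpa only [mul_one] using (fH.inner fP).mul fi2
  have f1 : IsLipFamily (fun x => v x * v x)
      (fun ε x => (inner ℝ (m x + ε • r x) (rot (p x + ε • q x))
      * ‖p x + ε • q x‖⁻¹ ^ 3 + δ * (inner ℝ (h x + ε • k x) (p x + ε • q x)
      * ‖p x + ε • q x‖⁻¹ ^ 2)) ^ 2 * ‖p x + ε • q x‖) := by
    simpa only [mul_one, ← pow_two] using (fN.mul fN).mul fP.norm
  have f2 : IsLipFamily (fun x => v x * v x)
      (fun ε x => ‖h x + ε • k x‖ ^ 2 * ‖p x + ε • q x‖⁻¹ ^ 2 * ‖p x + ε • q x‖) := by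
    simpa only [mul_one, ← pow_two] using ((fH.norm.mul fH.norm).mul fi2).mul fP.norm
  have f3 : IsLipFamily (fun _ => 1) (fun ε x => ‖p x + ε • q x‖) := fP.norm
  have f3' : IsLipFamily (fun x => v x * v x) (fun ε x => ‖p x + ε • q x‖) := by
    obtain ⟨s, hs, K, hK, hf⟩ := f3
    refine ⟨s, hs, K, hK, fun ε hε ε' hε' x => ?_⟩
    obtain ⟨a1, a2⟩ := hf ε hε ε' hε' x
    have hvx : 1 ≤ v x := by
      simp only [hv]
      linarith [norm_nonneg (m x), norm_nonneg (r x), norm_nonneg (h x), norm_nonneg (k x)]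
    have hvx2 : 1 ≤ v x * v x := by nlinarith
    have : K * 1 ≤ K * (v x * v x) := by gcongr
    exact ⟨a1.trans this, a2.trans (by gcongr)⟩
  have f : IsLipFamily (fun x => v x * v x)
      (fun ε x => energyDensity δ lam (p x + ε • q x) (m x + ε • r x) (h x + ε • k x)) :=
    ((f1.const_mul _).add (f2.const_mul _)).add f3'
  have mP : ∀ ε : ℝ, Measurable (fun x => p x + ε • q x) := fun ε => mp.add (mq.const_smul ε)
  have mM : ∀ ε : ℝ, Measurable (fun x => m x + ε • r x) := fun ε => mm.add (mr.const_smul ε)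
  have mH : ∀ ε : ℝ, Measurable (fun x => h x + ε • k x) := fun ε => mh.add (mk.const_smul ε)
  have m1 := fun ε => measurable_bendingDensity (mP ε) (mM ε) (mH ε) δ
  have m2 := fun ε => measurable_gradDensity (mP ε) (mH ε)
  have mf := fun ε => measurable_energyDensity (mP ε) (mM ε) (mH ε) δ lam
  have n1 : Measurable fun x => inner ℝ (densityDerivM δ c (p x) (m x) (h x)) (r x) :=
    (measurable_densityDerivM mp mm mh δ c).inner mr
  have n2 : Measurable fun x => inner ℝ (densityDerivP δ lam c (p x) (m x) (h x)) (q x) :=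
    (measurable_densityDerivP mp mm mh δ lam c).inner mq
  have n3 : Measurable fun x => inner ℝ (densityDerivH δ lam c (p x) (m x) (h x)) (k x) :=
    (measurable_densityDerivH mp mm mh δ lam c).inner mk
  have md := (n1.add n2).add n3
  obtain ⟨-, hD⟩ := f.hasDerivAt_integral hv2 mf md
    (fun x => hasDerivAt_energyDensity δ lam hc (hγc x) (m x) (h x) (q x) (r x) (k x))
  obtain ⟨s1, hs1, i1⟩ := f1.integrable hv2 m1
  obtain ⟨s2, hs2, i2⟩ := f2.integrable hv2 m2
  obtain ⟨s3, hs3, i3⟩ := f3.integrable hv1 (fun ε => (mP ε).norm)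
  -- For small ε the energy equals the integral of the density, whose derivative has just been
  -- computed; by criticality that derivative is also 0.
  refine hD.unique ((hcrit φ ψ hφ hψ).congr_of_eventuallyEq ?_)
  have hnear : ∀ {s : ℝ}, 0 < s → ∀ᶠ ε in nhds (0 : ℝ), |ε| < s := fun {s} hs => by
    filter_upwards [Metric.ball_mem_nhds (0 : ℝ) hs] with ε hε
    simpa using hε
  filter_upwards [hnear hs1, hnear hs2, hnear hs3, hnear hs] with ε e1 e2 e3 e4
  have d1 : deriv (γ + ε • φ) = fun x => p x + ε • q x := funext fun x =>
    ((hγ.hasDerivAt x).add ((hφ.hasDerivAt x).const_smul ε)).deriv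
  have d2 : ∀ᵐ x, HasDerivAt (fun x => p x + ε • q x) (m x + ε • r x) x := by
    filter_upwards [hp.isPrimitive.ae_hasDerivAt, hq.isPrimitive.ae_hasDerivAt] with x h1 h2
    exact h1.add (h2.const_smul ε)
  have d3 : ∀ᵐ x, deriv (η + ε • ψ) x = h x + ε • k x := by
    filter_upwards [hh.isPrimitive.ae_hasDerivAt, hk.isPrimitive.ae_hasDerivAt] with x h1 h2
    exact (h1.add (h2.const_smul ε)).deriv
  have d2' : ∀ᵐ x, deriv (fun x => p x + ε • q x) x = m x + ε • r x := by
    filter_upwards [d2] with x hx using hx.deriv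
  rw [energyLM_eq]
  · rw [d1]
    refine integral_congr_ae (ae_periodMeasure_of_ae ?_)
    filter_upwards [d2', d3] with x h2 h3
    rw [h2, h3]
  · intro x hx
    have := hlow ε e4 x
    rw [d1] at hx
    simp only [hx, norm_zero] at this
    linarith
  · rw [d1]
    filter_upwards [d2, d2'] with x h2 h3
    rwa [h3]
  · rw [d1]
    refine (i1 ε e1).congr (ae_periodMeasure_of_ae ?_)
    filter_upwards [d2', d3] with x h2 h3
    rw [h2, h3]
  · rw [d1]
    refine (i2 ε e2).congr (ae_periodMeasure_of_ae ?_)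
    filter_upwards [d3] with x h3
    rw [h3]
  · rw [d1]
    exact i3 ε e3

/-! ### Pointwise estimates and identities -/

section Pointwise

variable {δ lam c : ℝ} {p m h : Plane}

theorem abs_coupledCurvature_le (δ : ℝ) (hc : 0 < c) (hp : ‖p‖ = c) (m h : Plane) :
    |coupledCurvature δ c p m h| ≤ ‖m‖ / c ^ 2 + |δ| / c * ‖h‖ := by
  have h1 : |inner ℝ m (rot p)| ≤ ‖m‖ * c := by
    simpa [norm_rot, hp] using abs_real_inner_le_norm m (rot p)
  have h2 : |inner ℝ h p| ≤ ‖h‖ * c := by simpa [hp] using abs_real_inner_le_norm h p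
  rw [coupledCurvature]
  refine (abs_add_le _ _).trans ?_
  rw [abs_div, abs_div, abs_mul, abs_of_pos (pow_pos hc 3), abs_of_pos (pow_pos hc 2)]
  calc _ ≤ ‖m‖ * c / c ^ 3 + |δ| * (‖h‖ * c) / c ^ 2 := by gcongr
    _ = _ := by field_simp

/-- Growth is quadratic, the mixed products being absorbed by 2xy ≤ x² + y². The square of w is kept
apart from those of m and h because its integral has a bound of its own. -/
theorem norm_densityDerivP_le (δ : ℝ) (hlam : 0 < lam) (hc : 0 < c) (hp : ‖p‖ = c) (m h : Plane) :
    ‖densityDerivP δ lam c p m h‖ ≤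
      (2 * c⁻¹ ^ 2 + 3 / 2 * |δ| * c⁻¹ + 1 / 2) * coupledCurvature δ c p m h ^ 2
        + 2 * c⁻¹ ^ 2 * ‖m‖ ^ 2 + (3 / 2 * |δ| * c⁻¹ + lam / 2 * c⁻¹ ^ 2) * ‖h‖ ^ 2 + 1 := by
  set w := coupledCurvature δ c p m h with hw
  have h1 : |inner ℝ m (rot p)| ≤ ‖m‖ * c := by
    simpa [norm_rot, hp] using abs_real_inner_le_norm m (rot p)
  have h2 : |inner ℝ h p| ≤ ‖h‖ * c := by simpa [hp] using abs_real_inner_le_norm h p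
  have b1 : ‖-(1 / c ^ 3) • rot m‖ = 1 / c ^ 3 * ‖m‖ := by
    rw [norm_smul, norm_rot, norm_neg, Real.norm_of_nonneg (by positivity)]
  have b2 : ‖(δ / c ^ 2) • h‖ = |δ| / c ^ 2 * ‖h‖ := by
    rw [norm_smul, norm_div, Real.norm_eq_abs, Real.norm_of_nonneg (by positivity)]
  have b3 : ‖(3 * inner ℝ m (rot p) / c ^ 5 + 2 * δ * inner ℝ h p / c ^ 4) • p‖
      ≤ (3 * (‖m‖ * c) / c ^ 5 + 2 * |δ| * (‖h‖ * c) / c ^ 4) * c := by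
    rw [norm_smul, hp]
    refine mul_le_mul_of_nonneg_right ?_ hc.le
    refine (norm_add_le _ _).trans ?_
    rw [norm_div, norm_div, norm_mul, norm_mul, norm_mul, Real.norm_of_nonneg (pow_pos hc 5).le,
      Real.norm_of_nonneg (pow_pos hc 4).le, Real.norm_eq_abs δ, Real.norm_ofNat, Real.norm_ofNat,
      Real.norm_eq_abs, Real.norm_eq_abs]
    gcongr
  have b4 : ‖(w ^ 2 / (2 * c) - lam * ‖h‖ ^ 2 / (2 * c ^ 3) + 1 / c) • p‖
      ≤ (w ^ 2 / (2 * c) + lam * ‖h‖ ^ 2 / (2 * c ^ 3) + 1 / c) * c := by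
    rw [norm_smul, hp]
    refine mul_le_mul_of_nonneg_right ?_ hc.le
    have q1 : 0 ≤ w ^ 2 / (2 * c) := by positivity
    have q2 : 0 ≤ lam * ‖h‖ ^ 2 / (2 * c ^ 3) := by positivity
    have q3 : 0 ≤ 1 / c := by positivity
    rw [Real.norm_eq_abs, abs_le]
    constructor <;> linarith
  have key : ‖densityDerivP δ lam c p m h‖ ≤ |w| * c * (1 / c ^ 3 * ‖m‖ + |δ| / c ^ 2 * ‖h‖
      + (3 * (‖m‖ * c) / c ^ 5 + 2 * |δ| * (‖h‖ * c) / c ^ 4) * c)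
      + (w ^ 2 / (2 * c) + lam * ‖h‖ ^ 2 / (2 * c ^ 3) + 1 / c) * c := by
    rw [densityDerivP, ← hw]
    refine (norm_add_le _ _).trans (add_le_add ?_ b4)
    rw [norm_smul, norm_mul, Real.norm_eq_abs, Real.norm_of_nonneg hc.le]
    refine mul_le_mul_of_nonneg_left ?_ (by positivity)
    refine (norm_sub_le _ _).trans (add_le_add ((norm_add_le _ _).trans ?_) b3)
    rw [b1, b2]
  refine key.trans ?_
  have e : |w| * c * (1 / c ^ 3 * ‖m‖ + |δ| / c ^ 2 * ‖h‖
      + (3 * (‖m‖ * c) / c ^ 5 + 2 * |δ| * (‖h‖ * c) / c ^ 4) * c)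
      + (w ^ 2 / (2 * c) + lam * ‖h‖ ^ 2 / (2 * c ^ 3) + 1 / c) * c
      = 2 * c⁻¹ ^ 2 * (2 * (|w| * ‖m‖)) + 3 / 2 * |δ| * c⁻¹ * (2 * (|w| * ‖h‖)) + 1 / 2 * w ^ 2
        + lam / 2 * c⁻¹ ^ 2 * ‖h‖ ^ 2 + 1 := by
    field_simp; ring
  rw [e]
  have i1 : 2 * (|w| * ‖m‖) ≤ w ^ 2 + ‖m‖ ^ 2 := by
    nlinarith [sq_nonneg (|w| - ‖m‖), sq_abs w]
  have i2 : 2 * (|w| * ‖h‖) ≤ w ^ 2 + ‖h‖ ^ 2 := by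
    nlinarith [sq_nonneg (|w| - ‖h‖), sq_abs w]
  have j1 := mul_le_mul_of_nonneg_left i1 (show 0 ≤ 2 * c⁻¹ ^ 2 by positivity)
  have j2 := mul_le_mul_of_nonneg_left i2 (show 0 ≤ 3 / 2 * |δ| * c⁻¹ by positivity)
  linarith

theorem eq_smul_rot_of_inner_eq_zero (hc : 0 < c) (hp : ‖p‖ = c) (hm : inner ℝ m p = 0) :
    m = (inner ℝ m (rot p) / c ^ 2) • rot p := by
  have h1 := plane_norm_sq p
  rw [hp] at h1
  rw [plane_inner] at hm
  rw [plane_inner]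
  refine plane_ext ?_ ?_
  · simp only [rot_zero_apply, rot_one_apply, PiLp.smul_apply, smul_eq_mul]
    field_simp
    rw [h1]
    linear_combination (p 0) * hm
  · simp only [rot_zero_apply, rot_one_apply, PiLp.smul_apply, smul_eq_mul]
    field_simp
    rw [h1]
    linear_combination (p 1) * hm

theorem eq_of_densityDerivH_eq (hlam : 0 < lam) (hc : 0 < c) {a : Plane}
    (h1 : densityDerivH δ lam c p m h = c⁻¹ • a) :
    h = lam⁻¹ • (a - (δ * coupledCurvature δ c p m h) • p) := by
  rw [densityDerivH] at h1
  have h2 : c • ((δ * coupledCurvature δ c p m h / c) • p + (lam / c) • h) = a := by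
    rw [h1, smul_smul, mul_inv_cancel₀ hc.ne', one_smul]
  rw [smul_add, smul_smul, smul_smul, mul_div_cancel₀ _ hc.ne', mul_div_cancel₀ _ hc.ne'] at h2
  rw [← h2, add_sub_cancel_left, smul_smul, inv_mul_cancel₀ hlam.ne', one_smul]

/-- The equation for η eliminates h from the definition of w. The coefficient of w becomes 1 + δ² /
λ, and the normal part of m is a function of w, p and a. -/
theorem inner_rot_eq_of_eq (hlam : 0 < lam) (hc : 0 < c) (hp : ‖p‖ = c) {a : Plane}
    (h1 : h = lam⁻¹ • (a - (δ * coupledCurvature δ c p m h) • p)) :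
    inner ℝ m (rot p) = c ^ 3 * ((1 + δ ^ 2 / lam) * coupledCurvature δ c p m h
      - δ / (lam * c ^ 2) * inner ℝ a p) := by
  set w := coupledCurvature δ c p m h with hw
  have h2 : inner ℝ h p = lam⁻¹ * (inner ℝ a p - δ * w * c ^ 2) := by
    rw [h1, inner_smul_left, inner_sub_left, inner_smul_left, real_inner_self_eq_norm_sq, hp]
    simp
  have h3 : c ^ 3 * w = inner ℝ m (rot p) + c * δ * inner ℝ h p := by
    rw [hw, coupledCurvature]; field_simp
  rw [eq_sub_of_add_eq h3.symm, h2]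
  field_simp
  ring

/-- The decisive cancellation. As m ⊥ p, also Jm ⊥ Jp; multiples of p are orthogonal to Jp as well.
Only the h term survives, and its part along p drops out too, so nothing quadratic remains. -/
theorem inner_densityDerivP_rot (hlam : 0 < lam) (hc : 0 < c) (hm : inner ℝ m p = 0)
    {a : Plane} (h1 : h = lam⁻¹ • (a - (δ * coupledCurvature δ c p m h) • p)) :
    inner ℝ (densityDerivP δ lam c p m h) (rot p) =
      δ / (c * lam) * coupledCurvature δ c p m h * inner ℝ a (rot p) := by
  have h2 : inner ℝ h (rot p) = lam⁻¹ * inner ℝ a (rot p) := by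
    rw [h1, inner_smul_left, inner_sub_left, inner_smul_left, inner_rot_self]
    simp
  simp only [densityDerivP, inner_add_left, inner_smul_left, inner_sub_left, inner_rot_self,
    inner_rot_rot, hm, h2]
  simp
  field_simp

end Pointwise

/-! ### The Euler-Lagrange system -/

/-- The Euler-Lagrange equations of `E_LM` along a curve with `|∂_x γ| = c`, as a first order
system for `∂_x γ`, `η` and the continuous representative `W` of `κ + δ div_γ η`. -/
structure EulerLagrange (δ lam c : ℝ) (γ η : ℝ → Plane) (W : ℝ → ℝ) (a b : Plane) : Prop where
  hasDerivAt_deriv : ∀ x, HasDerivAt (deriv γ) ((c * ((1 + δ ^ 2 / lam) * W x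
    - δ / (lam * c ^ 2) * inner ℝ a (deriv γ x))) • rot (deriv γ x)) x
  hasDerivAt_curv : ∀ x, HasDerivAt W (δ / (c * lam) * W x * inner ℝ a (rot (deriv γ x))
    - inner ℝ b (rot (deriv γ x))) x
  hasDerivAt_field : ∀ x, HasDerivAt η (lam⁻¹ • (a - (δ * W x) • deriv γ x)) x
  periodic : Function.Periodic W (2 * Real.pi)
  curv_ae : ∀ᵐ x, W x = coupledCurvature δ c (deriv γ x) (deriv (deriv γ) x) (deriv η x)
  mean_eq : b = (2 * Real.pi)⁻¹ • ∫ x in (0 : ℝ)..(2 * Real.pi),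
    densityDerivP δ lam c (deriv γ x) (deriv (deriv γ) x) (deriv η x)

section

variable {δ lam c : ℝ} {γ η : ℝ → Plane}

theorem memLp_coupledCurvature (δ : ℝ) (hγ : MemHPer 2 γ) (hη : MemHPer 1 η) (hc : 0 < c)
    (hγc : ∀ x, ‖deriv γ x‖ = c) :
    MemLp (fun x => coupledCurvature δ c (deriv γ x) (deriv (deriv γ) x) (deriv η x)) 2
      periodMeasure := by
  have h1 : MemLp (fun x => c⁻¹ ^ 2 * ‖deriv (deriv γ) x‖ + |δ| / c * ‖deriv η x‖) 2 periodMeasure :=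
    (hγ.hasH1Deriv_deriv.memLp.norm.const_mul _).add (hη.hasH1Deriv.memLp.norm.const_mul _)
  refine h1.mono' (measurable_coupledCurvature (measurable_deriv _) (measurable_deriv _)
    (measurable_deriv _) δ c).aestronglyMeasurable (Filter.Eventually.of_forall fun x => ?_)
  refine (abs_coupledCurvature_le δ hc (hγc x) _ _).trans (le_of_eq ?_)
  field_simp

theorem memLp_densityDerivM (δ : ℝ) (hγ : MemHPer 2 γ) (hη : MemHPer 1 η) (hc : 0 < c)
    (hγc : ∀ x, ‖deriv γ x‖ = c) :
    MemLp (fun x => densityDerivM δ c (deriv γ x) (deriv (deriv γ) x) (deriv η x)) 2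
      periodMeasure := by
  have h1 := (memLp_coupledCurvature δ hγ hη hc hγc).norm.const_mul c⁻¹
  refine h1.mono' (measurable_densityDerivM (measurable_deriv _) (measurable_deriv _)
    (measurable_deriv _) δ c).aestronglyMeasurable (Filter.Eventually.of_forall fun x => ?_)
  rw [densityDerivM, norm_smul, norm_rot, hγc, norm_div, Real.norm_of_nonneg (pow_pos hc 2).le]
  refine le_of_eq ?_
  field_simp

theorem memLp_densityDerivH (δ lam : ℝ) (hγ : MemHPer 2 γ) (hη : MemHPer 1 η) (hc : 0 < c)
    (hγc : ∀ x, ‖deriv γ x‖ = c) :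
    MemLp (fun x => densityDerivH δ lam c (deriv γ x) (deriv (deriv γ) x) (deriv η x)) 2
      periodMeasure := by
  have h1 := ((memLp_coupledCurvature δ hγ hη hc hγc).norm.const_mul |δ|).add
    (hη.hasH1Deriv.memLp.norm.const_mul (|lam| / c))
  refine h1.mono' (measurable_densityDerivH (measurable_deriv _) (measurable_deriv _)
    (measurable_deriv _) δ lam c).aestronglyMeasurable (Filter.Eventually.of_forall fun x => ?_)
  rw [densityDerivH]
  refine (norm_add_le _ _).trans (le_of_eq ?_)
  rw [norm_smul, norm_smul, hγc, norm_div, norm_div, norm_mul, Real.norm_of_nonneg hc.le,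
    div_mul_cancel₀ _ hc.ne']
  simp

theorem integrable_densityDerivP (δ : ℝ) (hlam : 0 < lam) (hγ : MemHPer 2 γ) (hη : MemHPer 1 η)
    (hc : 0 < c) (hγc : ∀ x, ‖deriv γ x‖ = c) :
    Integrable (fun x => densityDerivP δ lam c (deriv γ x) (deriv (deriv γ) x) (deriv η x))
      periodMeasure := by
  refine Integrable.mono' (((((memLp_coupledCurvature δ hγ hη hc hγc).integrable_sq.const_mul
    (2 * c⁻¹ ^ 2 + 3 / 2 * |δ| * c⁻¹ + 1 / 2)).add
    (hγ.hasH1Deriv_deriv.memLp.norm.integrable_sq.const_mul (2 * c⁻¹ ^ 2))).add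
    (hη.hasH1Deriv.memLp.norm.integrable_sq.const_mul
      (3 / 2 * |δ| * c⁻¹ + lam / 2 * c⁻¹ ^ 2))).add (integrable_const 1))
    (measurable_densityDerivP (measurable_deriv _) (measurable_deriv _)
    (measurable_deriv _) δ lam c).aestronglyMeasurable (Filter.Eventually.of_forall fun x => ?_)
  exact norm_densityDerivP_le δ hlam hc (hγc x) _ _

theorem hasH1Deriv_zero : HasH1Deriv (fun _ => 0) (fun _ => 0) where
  periodic _ := rfl
  periodic_deriv _ := rfl
  isPrimitive := IsPrimitive.of_hasDerivAt (fun x => hasDerivAt_const x 0) continuous_const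
  memLp := memLp_const 0

theorem memHPer_two_zero : MemHPer 2 (fun _ => 0) :=
  hasH1Deriv_zero.memHPer_two (fun _ => rfl)
    (IsPrimitive.of_hasDerivAt (fun x => hasDerivAt_const x 0) continuous_const)

/-- The Euler-Lagrange equation for variations of `η`. -/
theorem IsCriticalPoint.exists_densityDerivH_eq (hγ : MemHPer 2 γ) (hη : MemHPer 1 η) (hc : 0 < c)
    (hγc : ∀ x, ‖deriv γ x‖ = c) (hcrit : IsCriticalPoint δ lam γ η) :
    ∃ d : Plane, ∀ᵐ x,
      densityDerivH δ lam c (deriv γ x) (deriv (deriv γ) x) (deriv η x) = d := by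
  have hp := hγ.hasH1Deriv_deriv
  have hh := hη.hasH1Deriv
  refine ae_eq_mean_of_orthogonal (fun x => by
    rw [hp.periodic x, hp.periodic_deriv x, hh.periodic_deriv x])
    (memLp_densityDerivH δ lam hγ hη hc hγc) fun k hkp hk hk0 => ?_
  -- Every mean-zero k is the derivative of an admissible ψ; the variation is taken with φ = 0.
  obtain ⟨ψ, hψ, -⟩ := exists_hasH1Deriv hkp hk hk0
  have h1 := hcrit.firstVariation hγ hη hc hγc memHPer_two_zero hψ.memHPer
  rw [← integral_periodMeasure, ← h1]
  refine integral_congr_ae (ae_periodMeasure_of_ae ?_)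
  filter_upwards [hψ.isPrimitive.ae_deriv_eq] with x hx
  rw [hx]
  simp

/-- The Euler-Lagrange equation for variations of `γ`. -/
theorem IsCriticalPoint.exists_densityDerivM_eq (hlam : 0 < lam) (hγ : MemHPer 2 γ)
    (hη : MemHPer 1 η) (hc : 0 < c)
    (hγc : ∀ x, ‖deriv γ x‖ = c) (hcrit : IsCriticalPoint δ lam γ η) {b : Plane}
    (hb : b = (2 * Real.pi)⁻¹ • ∫ x in (0 : ℝ)..(2 * Real.pi),
      densityDerivP δ lam c (deriv γ x) (deriv (deriv γ) x) (deriv η x)) :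
    ∃ V : ℝ → Plane, Function.Periodic V (2 * Real.pi) ∧ IsPrimitive V
      (fun x => densityDerivP δ lam c (deriv γ x) (deriv (deriv γ) x) (deriv η x) - b) ∧
      ∀ᵐ x, densityDerivM δ c (deriv γ x) (deriv (deriv γ) x) (deriv η x) = V x := by
  have hp := hγ.hasH1Deriv_deriv
  have hh := hη.hasH1Deriv
  set Fp := fun x => densityDerivP δ lam c (deriv γ x) (deriv (deriv γ) x) (deriv η x) with hFp
  set Fm := fun x => densityDerivM δ c (deriv γ x) (deriv (deriv γ) x) (deriv η x) with hFm
  have hFmL : MemLp Fm 2 periodMeasure := memLp_densityDerivM δ hγ hη hc hγc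
  have hFpp : Function.Periodic Fp (2 * Real.pi) := fun x => by
    simp only [hFp]
    rw [hp.periodic x, hp.periodic_deriv x, hh.periodic_deriv x]
  have hFmp : Function.Periodic Fm (2 * Real.pi) := fun x => by
    simp only [hFm]
    rw [hp.periodic x, hp.periodic_deriv x, hh.periodic_deriv x]
  have hFpi : Integrable Fp periodMeasure := integrable_densityDerivP δ hlam hγ hη hc hγc
  have hgi : Integrable (fun x => Fp x - b) periodMeasure := hFpi.sub (integrable_const b)
  have hgp : Function.Periodic (fun x => Fp x - b) (2 * Real.pi) := fun x => by simp only [hFpp x]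
  have hg0 : ∫ x in (0 : ℝ)..(2 * Real.pi), (Fp x - b) = 0 := by
    rw [intervalIntegral.integral_sub (integrable_periodMeasure_iff.1 hFpi)
      (continuous_const.intervalIntegrable _ _), intervalIntegral.integral_const, sub_zero, hb,
      smul_smul, mul_inv_cancel₀ two_pi_pos.ne', one_smul, sub_self]
  -- Subtracting the mean b from F_p makes its primitive G periodic.
  have hG := IsPrimitive.of_integral (hgp.locallyIntegrable hgi) 0
  set G : ℝ → Plane := fun x => 0 + ∫ t in (0 : ℝ)..x, (Fp t - b) with hGdef
  have hGp : Function.Periodic G (2 * Real.pi) := periodic_primitive hG hgp hg0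
  have hGL : MemLp G 2 periodMeasure := hG.continuous.memLp_periodMeasure 2
  obtain ⟨d, hd⟩ := ae_eq_mean_of_orthogonal (u := fun x => Fm x - G x)
    (fun x => by simp only [hGp x, hFmp x]) (hFmL.sub hGL) fun r hrp hr hr0 => by
      -- The test function φ is a second primitive of r. Since q has mean zero, integration by parts
      -- gives ∫ ⟨F_p, q⟩ = −∫ ⟨G, r⟩, so F_m − G is orthogonal to r.
      obtain ⟨q, hq, hq0⟩ := exists_hasH1Deriv hrp hr hr0
      have hφ := IsPrimitive.of_integral hq.continuous.locallyIntegrable 0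
      have hφ2 := hq.memHPer_two (periodic_primitive hφ hq.periodic hq0) hφ
      have hφd := fun x => (hφ.hasDerivAt Filter.EventuallyEq.rfl hq.continuous x).deriv
      have h1 := hcrit.firstVariation hγ hη hc hγc hφ2 hasH1Deriv_zero.memHPer
      have hφd' := funext hφd
      have h2 : ∫ x, (inner ℝ (Fm x) (r x) + inner ℝ (Fp x) (q x)) ∂periodMeasure = 0 := by
        rw [← h1]
        refine integral_congr_ae (ae_periodMeasure_of_ae ?_)
        rw [hφd']
        filter_upwards [hq.isPrimitive.ae_deriv_eq] with x hx
        rw [hx]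
        simp [hFm, hFp]
      have i1 : Integrable (fun x => inner ℝ (Fm x) (r x)) periodMeasure :=
        integrable_inner_of_memLp hFmL hr
      have i2 : Integrable (fun x => inner ℝ (G x) (r x)) periodMeasure :=
        integrable_inner_of_memLp hGL hr
      have i4 : Integrable (fun x => inner ℝ b (q x)) periodMeasure :=
        integrable_inner_of_memLp (memLp_const b) (hq.continuous.memLp_periodMeasure 2)
      have h3 := (hG.inner hq.isPrimitive)
      have h4 := h3.integral_eq 0 (2 * Real.pi)
      have e1 : G (2 * Real.pi) = G 0 := by simpa using hGp 0
      have e2 : q (2 * Real.pi) = q 0 := by simpa using hq.periodic 0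
      have h5 : ∫ x, inner ℝ b (q x) ∂periodMeasure = 0 := by
        rw [integral_inner ((hq.continuous.memLp_periodMeasure 1).integrable le_rfl),
          integral_periodMeasure, hq0, inner_zero_right]
      rw [e1, e2, sub_self, ← integral_periodMeasure] at h4
      have i5 : Integrable (fun x => inner ℝ (Fp x - b) (q x) + inner ℝ (G x) (r x))
          periodMeasure := integrable_periodMeasure_iff.2 (h3.intervalIntegrable _ _)
      -- F_p is only in L¹, so its pairing with q is recovered from the integrable derivative of ⟨G,
      -- q⟩.
      have i6 : Integrable (fun x => inner ℝ (Fm x) (r x) + inner ℝ (Fp x) (q x))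
          periodMeasure := by
        have := (i1.add (i5.sub i2)).add i4
        refine this.congr (Filter.Eventually.of_forall fun x => ?_)
        simp only [Pi.add_apply, Pi.sub_apply, inner_sub_left]
        ring
      rw [← integral_periodMeasure]
      have h6 : ∀ x, inner ℝ (Fm x - G x) (r x) =
          (inner ℝ (Fm x) (r x) + inner ℝ (Fp x) (q x)) -
          (inner ℝ (Fp x - b) (q x) + inner ℝ (G x) (r x)) - inner ℝ b (q x) := fun x => by
        simp only [inner_sub_left]; ring
      simp_rw [h6]
      have e3 := integral_sub (i6.sub i5) i4
      have e4 := integral_sub i6 i5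
      simp only [Pi.sub_apply] at e3 e4
      rw [e3, e4, h2, h4, h5]
      simp
  refine ⟨fun x => G x - (-d), fun x => by simp only [hGp x], hG.sub_const _, ?_⟩
  filter_upwards [hd] with x hx
  rw [← hx]
  abel

theorem MemHPer.ae_inner_deriv_deriv_eq_zero (hγ : MemHPer 2 γ) (hγc : ∀ x, ‖deriv γ x‖ = c) :
    ∀ᵐ x, inner ℝ (deriv (deriv γ) x) (deriv γ x) = 0 := by
  filter_upwards [hγ.hasH1Deriv_deriv.isPrimitive.ae_hasDerivAt] with x hx
  have h1 := hx.norm_sq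
  simp only [hγc] at h1
  have h2 := h1.unique (hasDerivAt_const x (c ^ 2))
  rw [real_inner_comm] at h2
  linarith

/-- Critical points solve the Euler-Lagrange system. -/
theorem IsCriticalPoint.exists_eulerLagrange (hlam : 0 < lam) (hγ : MemHPer 2 γ)
    (hη : MemHPer 1 η) (hc : 0 < c)
    (hγc : ∀ x, ‖deriv γ x‖ = c) (hcrit : IsCriticalPoint δ lam γ η) :
    ∃ (W : ℝ → ℝ) (a b : Plane), EulerLagrange δ lam c γ η W a b := by
  have hp := hγ.hasH1Deriv_deriv
  have hh := hη.hasH1Deriv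
  obtain ⟨d, hd⟩ := hcrit.exists_densityDerivH_eq hγ hη hc hγc
  obtain ⟨V, hVp, hV, hVM⟩ := hcrit.exists_densityDerivM_eq hlam hγ hη hc hγc rfl
  set a := c • d with ha
  set b := (2 * Real.pi)⁻¹ • ∫ x in (0 : ℝ)..(2 * Real.pi),
      densityDerivP δ lam c (deriv γ x) (deriv (deriv γ) x) (deriv η x) with hb
  have hJp : IsPrimitive (fun x => rot (deriv γ x)) (fun x => rot (deriv (deriv γ) x)) :=
    hp.isPrimitive.clm rotL
  have hmp := hγ.ae_inner_deriv_deriv_eq_zero hγc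
  have hh' : ∀ᵐ x, deriv η x = lam⁻¹ • (a - (δ * coupledCurvature δ c (deriv γ x)
      (deriv (deriv γ) x) (deriv η x)) • deriv γ x) := by
    filter_upwards [hd] with x hx
    refine eq_of_densityDerivH_eq hlam hc ?_
    rw [hx, ha, smul_smul, inv_mul_cancel₀ hc.ne', one_smul]
  -- V = c⁻² w Jp a.e. and |Jp| = c, so this pairing equals w a.e., while V and Jp are continuous.
  set W : ℝ → ℝ := fun x => inner ℝ (V x) (rot (deriv γ x)) with hWdef
  have hWp := hV.inner hJp
  have hWc : Continuous W := hWp.continuous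
  have hW : ∀ᵐ x, W x = coupledCurvature δ c (deriv γ x) (deriv (deriv γ) x) (deriv η x) := by
    filter_upwards [hVM] with x hx
    simp only [hWdef]
    rw [← hx, densityDerivM, inner_smul_left, inner_rot_rot, real_inner_self_eq_norm_sq, hγc]
    simp
    field_simp
  have hpc := hp.continuous
  have hJc := hJp.continuous
  refine ⟨W, a, b, ?_, ?_, ?_, ?_, hW, rfl⟩
  · refine hp.isPrimitive.hasDerivAt ?_ ?_
    · filter_upwards [hW, hh', hmp] with x h1 h2 h3
      have h4 := inner_rot_eq_of_eq hlam hc (hγc x) h2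
      rw [← h1] at h4
      conv_lhs => rw [eq_smul_rot_of_inner_eq_zero hc (hγc x) h3, h4]
      congr 1
      field_simp
    · exact (continuous_const.mul ((continuous_const.mul hWc).sub
        (continuous_const.mul (continuous_const.inner hpc)))).smul hJc
  · refine hWp.hasDerivAt ?_ ?_
    · filter_upwards [hW, hh', hmp, hVM] with x h1 h2 h3 h4
      rw [← h4, densityDerivM, inner_smul_left, inner_rot_rot,
        real_inner_comm (deriv (deriv γ) x) (deriv γ x), h3, inner_sub_left,
        inner_densityDerivP_rot hlam hc h3 h2, ← h1]
      simp
    · exact ((continuous_const.mul hWc).mul (continuous_const.inner hJc)).sub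
        (continuous_const.inner hJc)
  · refine hh.isPrimitive.hasDerivAt ?_ ?_
    · filter_upwards [hW, hh'] with x h1 h2
      rw [h1]
      exact h2
    · exact (continuous_const.sub ((continuous_const.mul hWc).smul hpc)).const_smul lam⁻¹
  · intro x
    simp only [hWdef, hVp x, hp.periodic x]

end

/-! ### Averages and sup bounds over a period -/

section Averages

variable {E : Type*} [NormedAddCommGroup E] [NormedSpace ℝ E]

theorem measureReal_periodMeasure : periodMeasure.real univ = 2 * Real.pi := by
  simp [periodMeasure, Real.pi_pos.le]

theorem integral_const_periodMeasure [CompleteSpace E] (a : E) : ∫ _, a ∂periodMeasure = (2 * Real.pi) • a := by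
  rw [integral_const, measureReal_periodMeasure]

/-- Integrates t ≤ 1/2 + t²/2 over a period of length 2π. -/
theorem integral_norm_le_of_memLp {E : Type*} [NormedAddCommGroup E] {f : ℝ → E} (hf : MemLp f 2 periodMeasure) :
    ∫ x, ‖f x‖ ∂periodMeasure ≤ Real.pi + 1 / 2 * ∫ x, ‖f x‖ ^ 2 ∂periodMeasure := by
  have h1 : ∫ x, (1 / 2 + 1 / 2 * ‖f x‖ ^ 2) ∂periodMeasure
      = Real.pi + 1 / 2 * ∫ x, ‖f x‖ ^ 2 ∂periodMeasure := by
    rw [integral_add (integrable_const _) (hf.norm.integrable_sq.const_mul _), integral_const_mul,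
      integral_const_periodMeasure, smul_eq_mul]
    ring
  rw [← h1]
  refine integral_mono (hf.norm.integrable one_le_two)
    ((integrable_const _).add (hf.norm.integrable_sq.const_mul _)) fun x => ?_
  simp only
  nlinarith [sq_nonneg (‖f x‖ - 1)]

theorem IsPrimitive.norm_sub_le {f g : ℝ → E} (h : IsPrimitive f g) {x y : ℝ}
    (hx : x ∈ Icc 0 (2 * Real.pi)) (hy : y ∈ Icc 0 (2 * Real.pi)) :
    ‖f x - f y‖ ≤ ∫ t, ‖g t‖ ∂periodMeasure := by
  rw [← h.integral_eq y x]
  refine intervalIntegral.norm_integral_le_integral_norm_uIoc.trans ?_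
  rw [periodMeasure]
  refine setIntegral_mono_set ?_ (Filter.Eventually.of_forall fun x => norm_nonneg _) ?_
  · exact (h.locallyIntegrable.integrableOn_isCompact isCompact_Icc).norm
  · refine (uIoc_subset_uIcc.trans ?_).eventuallyLE
    exact uIcc_subset_Icc hy hx

/-- A value is the mean plus the average of the differences f x − f t, each at most the total
variation over a period. -/
theorem IsPrimitive.norm_le [CompleteSpace E] {f g : ℝ → E} (h : IsPrimitive f g)
    (hp : Function.Periodic f (2 * Real.pi)) (x : ℝ) :
    ‖f x‖ ≤ (2 * Real.pi)⁻¹ * ‖∫ t, f t ∂periodMeasure‖ + ∫ t, ‖g t‖ ∂periodMeasure := by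
  obtain ⟨x', hx', hxx'⟩ := hp.exists_mem_Ico₀ two_pi_pos x
  rw [hxx']
  have hx := Ico_subset_Icc_self hx'
  have hi : Integrable f periodMeasure := (h.continuous.memLp_periodMeasure 1).integrable le_rfl
  have h1 : ∫ t, (f x' - f t) ∂periodMeasure
      = (2 * Real.pi) • f x' - ∫ t, f t ∂periodMeasure := by
    rw [integral_sub (integrable_const _) hi, integral_const_periodMeasure]
  have h2 : ‖∫ t, (f x' - f t) ∂periodMeasure‖
      ≤ (∫ t, ‖g t‖ ∂periodMeasure) * (2 * Real.pi) := by
    have := norm_integral_le_of_norm_le_const (μ := periodMeasure) (f := fun t => f x' - f t)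
      (C := ∫ t, ‖g t‖ ∂periodMeasure)
      ((ae_restrict_iff' measurableSet_Icc).2 (Filter.Eventually.of_forall fun t ht =>
        h.norm_sub_le hx ht))
    rwa [measureReal_periodMeasure] at this
  have h3 : f x' = (2 * Real.pi)⁻¹ • (∫ t, f t ∂periodMeasure
      + ∫ t, (f x' - f t) ∂periodMeasure) := by
    rw [h1, add_sub_cancel, smul_smul, inv_mul_cancel₀ two_pi_pos.ne', one_smul]
  have hpi := inv_pos.2 two_pi_pos
  calc ‖f x'‖ = (2 * Real.pi)⁻¹ * ‖∫ t, f t ∂periodMeasure + ∫ t, (f x' - f t) ∂periodMeasure‖ := by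
        conv_lhs => rw [h3, norm_smul, Real.norm_of_nonneg hpi.le]
    _ ≤ (2 * Real.pi)⁻¹ * (‖∫ t, f t ∂periodMeasure‖
          + (∫ t, ‖g t‖ ∂periodMeasure) * (2 * Real.pi)) := by
        gcongr
        exact (norm_add_le _ _).trans (by gcongr)
    _ = _ := by
        have := two_pi_pos.ne'
        field_simp

theorem integral_norm_iteratedDeriv_sq_le (f : ℝ → Plane) {j k : ℕ} (hj : j ≤ k) :
    ∫ x, ‖iteratedDeriv j f x‖ ^ 2 ∂periodMeasure ≤ hNorm k f ^ 2 := by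
  have h0 : ∀ i, 0 ≤ ∫ x in (0 : ℝ)..(2 * Real.pi), ‖iteratedDeriv i f x‖ ^ 2 := fun i =>
    intervalIntegral.integral_nonneg two_pi_pos.le fun _ _ => by positivity
  rw [hNorm, Real.sq_sqrt (Finset.sum_nonneg fun i _ => h0 i), integral_periodMeasure]
  exact Finset.single_le_sum (f := fun i => ∫ x in (0 : ℝ)..(2 * Real.pi),
    ‖iteratedDeriv i f x‖ ^ 2) (fun i _ => h0 i) (Finset.mem_range.2 (by omega))

end Averages

/-! ### Dilations and the lower bound on the length -/

section Bounds

variable {δ lam c : ℝ} {γ η : ℝ → Plane}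

/-- Euler's identity for scaling (p, m) with h fixed: the two quadratic terms of the density are
homogeneous of degree −1, the length term of degree 1. -/
theorem inner_densityDeriv_dilation (δ lam : ℝ) (hc : 0 < c) {p : Plane} (hp : ‖p‖ = c)
    (m h : Plane) :
    inner ℝ (densityDerivM δ c p m h) m + inner ℝ (densityDerivP δ lam c p m h) p =
      c - c / 2 * coupledCurvature δ c p m h ^ 2 - lam / (2 * c) * ‖h‖ ^ 2 := by
  set w := coupledCurvature δ c p m h with hw
  have h3 : inner ℝ m (rot p) = c ^ 3 * w - c * δ * inner ℝ h p := by
    rw [hw, coupledCurvature]; field_simp; ring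
  have h4 : inner ℝ (rot p) m = inner ℝ m (rot p) := real_inner_comm _ _
  simp only [densityDerivM, densityDerivP, ← hw, inner_add_left, inner_smul_left, inner_sub_left,
    inner_rot_left m p, h4, h3, real_inner_self_eq_norm_sq, hp]
  simp
  field_simp
  ring

/-- Criticality under dilations of the curve balances the quadratic energy and the length. -/
theorem IsCriticalPoint.integral_sq_eq (hγ : MemHPer 2 γ) (hη : MemHPer 1 η) (hc : 0 < c)
    (hγc : ∀ x, ‖deriv γ x‖ = c) (hcrit : IsCriticalPoint δ lam γ η) :
    c / 2 * ∫ x, coupledCurvature δ c (deriv γ x) (deriv (deriv γ) x) (deriv η x) ^ 2 ∂periodMeasure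
      + lam / (2 * c) * ∫ x, ‖deriv η x‖ ^ 2 ∂periodMeasure = 2 * Real.pi * c := by
  have h1 := hcrit.firstVariation hγ hη hc hγc hγ hasH1Deriv_zero.memHPer
  have i1 := (memLp_coupledCurvature δ hγ hη hc hγc).integrable_sq
  have i2 := hη.hasH1Deriv.memLp.norm.integrable_sq
  have h2 : ∫ x, (c - c / 2 * coupledCurvature δ c (deriv γ x) (deriv (deriv γ) x) (deriv η x) ^ 2
      - lam / (2 * c) * ‖deriv η x‖ ^ 2) ∂periodMeasure = 0 := by
    rw [← h1]
    refine integral_congr_ae (Filter.Eventually.of_forall fun x => ?_)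
    simp only
    rw [inner_densityDeriv_dilation δ lam hc (hγc x)]
    simp
  have e1 := integral_sub ((integrable_const c).sub (i1.const_mul (c / 2)))
    (i2.const_mul (lam / (2 * c)))
  have e2 := integral_sub (integrable_const c) (i1.const_mul (c / 2))
  simp only [Pi.sub_apply] at e1 e2
  rw [e1, e2, integral_const_mul, integral_const_mul, integral_const_periodMeasure] at h2
  rw [smul_eq_mul] at h2
  linarith

theorem IsCriticalPoint.integral_coupledCurvature_sq_le (hlam : 0 < lam) (hγ : MemHPer 2 γ)
    (hη : MemHPer 1 η) (hc : 0 < c) (hγc : ∀ x, ‖deriv γ x‖ = c)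
    (hcrit : IsCriticalPoint δ lam γ η) :
    ∫ x, coupledCurvature δ c (deriv γ x) (deriv (deriv γ) x) (deriv η x) ^ 2 ∂periodMeasure
      ≤ 4 * Real.pi := by
  have h1 := hcrit.integral_sq_eq hγ hη hc hγc
  have h2 : 0 ≤ lam / (2 * c) * ∫ x, ‖deriv η x‖ ^ 2 ∂periodMeasure :=
    mul_nonneg (by positivity) (integral_nonneg fun x => by positivity)
  refine le_of_mul_le_mul_left ?_ (half_pos hc)
  linarith

theorem IsCriticalPoint.integral_deriv_field_sq_le (hlam : 0 < lam) (hγ : MemHPer 2 γ)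
    (hη : MemHPer 1 η) (hc : 0 < c) (hγc : ∀ x, ‖deriv γ x‖ = c)
    (hcrit : IsCriticalPoint δ lam γ η) :
    ∫ x, ‖deriv η x‖ ^ 2 ∂periodMeasure ≤ 4 * Real.pi * c ^ 2 / lam := by
  have h1 := hcrit.integral_sq_eq hγ hη hc hγc
  have h2 : 0 ≤ c / 2 *
      ∫ x, coupledCurvature δ c (deriv γ x) (deriv (deriv γ) x) (deriv η x) ^ 2 ∂periodMeasure :=
    mul_nonneg (by positivity) (integral_nonneg fun x => by positivity)
  have h3 : lam / (2 * c) * ∫ x, ‖deriv η x‖ ^ 2 ∂periodMeasure ≤ 2 * Real.pi * c := by linarith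
  refine le_of_mul_le_mul_left (h3.trans (le_of_eq ?_)) (show 0 < lam / (2 * c) by positivity)
  field_simp
  ring

/-- The length of a critical curve is bounded below. -/
theorem IsCriticalPoint.inv_speed_le (hlam : 0 < lam) (hγ : MemHPer 2 γ)
    (hη : MemHPer 1 η) (hc : 0 < c) (hγc : ∀ x, ‖deriv γ x‖ = c)
    (hcrit : IsCriticalPoint δ lam γ η) :
    c⁻¹ ≤ 3 * Real.pi + |δ| * (Real.pi + 2 * Real.pi / lam) := by
  have hp := hγ.hasH1Deriv_deriv
  have hh := hη.hasH1Deriv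
  have hw := memLp_coupledCurvature δ hγ hη hc hγc
  set w := fun x => coupledCurvature δ c (deriv γ x) (deriv (deriv γ) x) (deriv η x) with hwdef
  have hmean : ∫ x, deriv γ x ∂periodMeasure = 0 := by
    have := (IsPrimitive.of_hasDerivAt hγ.hasDerivAt hp.continuous).integral_eq 0 (2 * Real.pi)
    rw [integral_periodMeasure, this, ← hγ.periodic 0, zero_add, sub_self]
  -- The tangent of a closed curve has mean zero, so c is at most the integral of |m|.
  have h1 := hp.isPrimitive.norm_le hp.periodic 0
  rw [hmean, hγc, norm_zero, mul_zero, zero_add] at h1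
  -- The L² norm of h / c has a bound free of c, by the dilation identity.
  have hh1 : MemLp (fun x => c⁻¹ • deriv η x) 2 periodMeasure := hh.memLp.const_smul c⁻¹
  have h2 : ∫ x, ‖deriv (deriv γ) x‖ ∂periodMeasure ≤
      ∫ x, (c ^ 2 * ‖w x‖ + |δ| * c ^ 2 * ‖c⁻¹ • deriv η x‖) ∂periodMeasure := by
    refine integral_mono_ae (hp.memLp.norm.integrable one_le_two)
      (((hw.norm.integrable one_le_two).const_mul _).add
        ((hh1.norm.integrable one_le_two).const_mul _)) (ae_periodMeasure_of_ae ?_)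
    filter_upwards [hγ.ae_inner_deriv_deriv_eq_zero hγc] with x hx
    have e1 := eq_smul_rot_of_inner_eq_zero hc (hγc x) hx
    have e2 : inner ℝ (deriv (deriv γ) x) (rot (deriv γ x)) =
        c ^ 3 * w x - c * δ * inner ℝ (deriv η x) (deriv γ x) := by
      simp only [hwdef, coupledCurvature]; field_simp; ring
    have e3 : |inner ℝ (deriv η x) (deriv γ x)| ≤ ‖deriv η x‖ * c := by
      simpa [hγc x] using abs_real_inner_le_norm (deriv η x) (deriv γ x)
    have e4 : ‖deriv (deriv γ) x‖ =
        |c ^ 3 * w x - c * δ * inner ℝ (deriv η x) (deriv γ x)| / c ^ 2 * c := by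
      conv_lhs => rw [e1, e2, norm_smul, norm_rot, hγc, norm_div, Real.norm_eq_abs,
        Real.norm_of_nonneg (pow_pos hc 2).le]
    have e5 : |c ^ 3 * w x - c * δ * inner ℝ (deriv η x) (deriv γ x)|
        ≤ c ^ 3 * |w x| + c * |δ| * (‖deriv η x‖ * c) := by
      refine (abs_sub _ _).trans ?_
      rw [abs_mul, abs_mul, abs_mul, abs_of_pos hc, abs_of_pos (pow_pos hc 3)]
      gcongr
    rw [e4, norm_smul, norm_inv, Real.norm_of_nonneg hc.le, Real.norm_eq_abs]
    calc _ ≤ (c ^ 3 * |w x| + c * |δ| * (‖deriv η x‖ * c)) / c ^ 2 * c := by gcongr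
      _ = _ := by field_simp
  rw [integral_add ((hw.norm.integrable one_le_two).const_mul _)
    ((hh1.norm.integrable one_le_two).const_mul _), integral_const_mul, integral_const_mul] at h2
  have h3 := integral_norm_le_of_memLp hw
  have h4 := integral_norm_le_of_memLp hh1
  have h5 : ∫ x, ‖w x‖ ^ 2 ∂periodMeasure ≤ 4 * Real.pi := by
    simpa using hcrit.integral_coupledCurvature_sq_le hlam hγ hη hc hγc
  have h6 : ∫ x, ‖c⁻¹ • deriv η x‖ ^ 2 ∂periodMeasure ≤ 4 * Real.pi / lam := by
    have h7 := hcrit.integral_deriv_field_sq_le hlam hγ hη hc hγc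
    simp only [norm_smul, norm_inv, Real.norm_of_nonneg hc.le, mul_pow]
    rw [integral_const_mul]
    calc _ ≤ c⁻¹ ^ 2 * (4 * Real.pi * c ^ 2 / lam) := by gcongr
      _ = _ := by field_simp
  -- Linear in c on the left, quadratic on the right: dividing by c² bounds c⁻¹.
  have h8 : c ≤ c ^ 2 * (3 * Real.pi) + |δ| * c ^ 2 * (Real.pi + 2 * Real.pi / lam) := by
    refine h1.trans (h2.trans ?_)
    have e : 2 * Real.pi / lam = 1 / 2 * (4 * Real.pi / lam) := by ring
    have g1 : ∫ x, ‖w x‖ ∂periodMeasure ≤ 3 * Real.pi := by linarith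
    have g2 : ∫ x, ‖c⁻¹ • deriv η x‖ ∂periodMeasure ≤ Real.pi + 2 * Real.pi / lam := by
      rw [e]; linarith
    gcongr
  rw [inv_le_iff_one_le_mul₀ hc]
  refine le_of_mul_le_mul_left ?_ hc
  linarith

/-- The derivative of the periodic η has mean zero, so a is the mean of δ W p. -/
theorem EulerLagrange.norm_a_le {W : ℝ → ℝ} {a b : Plane} (hE : EulerLagrange δ lam c γ η W a b)
    (hη : MemHPer 1 η) (hlam : 0 < lam) (hγc : ∀ x, ‖deriv γ x‖ = c)
    (hγ : MemHPer 2 γ) : ‖a‖ ≤ (2 * Real.pi)⁻¹ * (|δ| * c * ∫ x, ‖W x‖ ∂periodMeasure) := by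
  have hWc : Continuous W := continuous_iff_continuousAt.2 fun x =>
    (hE.hasDerivAt_curv x).continuousAt
  have hpc := hγ.hasH1Deriv_deriv.continuous
  have h1 := hη.hasH1Deriv.integral_eq_zero
  have h2 : deriv η = fun x => lam⁻¹ • (a - (δ * W x) • deriv γ x) :=
    funext fun x => (hE.hasDerivAt_field x).deriv
  have i1 : Integrable (fun x => (δ * W x) • deriv γ x) periodMeasure :=
    (((continuous_const.mul hWc).smul hpc).memLp_periodMeasure 1).integrable le_rfl
  have i2 : Integrable W periodMeasure := (hWc.memLp_periodMeasure 1).integrable le_rfl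
  rw [h2, ← integral_periodMeasure, integral_smul, integral_sub (integrable_const _) i1,
    integral_const_periodMeasure, smul_eq_zero] at h1
  have h3 : (2 * Real.pi) • a = ∫ x, (δ * W x) • deriv γ x ∂periodMeasure :=
    sub_eq_zero.1 (h1.resolve_left (inv_ne_zero hlam.ne'))
  have h4 : a = (2 * Real.pi)⁻¹ • ∫ x, (δ * W x) • deriv γ x ∂periodMeasure := by
    rw [← h3, smul_smul, inv_mul_cancel₀ two_pi_pos.ne', one_smul]
  have hpi := inv_pos.2 two_pi_pos
  rw [h4, norm_smul, Real.norm_of_nonneg hpi.le]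
  refine mul_le_mul_of_nonneg_left ((norm_integral_le_integral_norm _).trans (le_of_eq ?_)) hpi.le
  rw [← integral_const_mul]
  congr 1
  funext x
  rw [norm_smul, norm_mul, hγc, Real.norm_eq_abs δ]
  ring

end Bounds

/-! ### Bounds on the data of the system -/

section UniformBounds

variable {δ lam c : ℝ} {γ η : ℝ → Plane} {W : ℝ → ℝ} {a b : Plane}

theorem EulerLagrange.integral_norm_curv_le (hE : EulerLagrange δ lam c γ η W a b)
    (hlam : 0 < lam) (hγ : MemHPer 2 γ) (hη : MemHPer 1 η) (hc : 0 < c)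
    (hγc : ∀ x, ‖deriv γ x‖ = c) (hcrit : IsCriticalPoint δ lam γ η) :
    ∫ x, ‖W x‖ ∂periodMeasure ≤ 3 * Real.pi := by
  have hw := memLp_coupledCurvature δ hγ hη hc hγc
  have h1 := integral_norm_le_of_memLp hw
  have h2 := hcrit.integral_coupledCurvature_sq_le hlam hγ hη hc hγc
  simp only [Real.norm_eq_abs, sq_abs] at h1
  have h3 : ∫ x, ‖W x‖ ∂periodMeasure =
      ∫ x, |coupledCurvature δ c (deriv γ x) (deriv (deriv γ) x) (deriv η x)| ∂periodMeasure := by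
    refine integral_congr_ae (ae_periodMeasure_of_ae ?_)
    filter_upwards [hE.curv_ae] with x hx
    rw [hx, Real.norm_eq_abs]
  rw [h3]
  linarith

theorem EulerLagrange.norm_b_le (hE : EulerLagrange δ lam c γ η W a b)
    (hlam : 0 < lam) (hγ : MemHPer 2 γ) (hη : MemHPer 1 η) (hc : 0 < c)
    (hγc : ∀ x, ‖deriv γ x‖ = c) (hcrit : IsCriticalPoint δ lam γ η) {D A B : ℝ} (hD : c⁻¹ ≤ D)
    (hA : ∫ x, ‖deriv (deriv γ) x‖ ^ 2 ∂periodMeasure ≤ A)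
    (hB : ∫ x, ‖deriv η x‖ ^ 2 ∂periodMeasure ≤ B) :
    ‖b‖ ≤ (2 * Real.pi)⁻¹ * ((2 * D ^ 2 + 3 / 2 * |δ| * D + 1 / 2) * (4 * Real.pi)
      + 2 * D ^ 2 * A + (3 / 2 * |δ| * D + lam / 2 * D ^ 2) * B + 2 * Real.pi) := by
  have hpi := inv_pos.2 two_pi_pos
  have hci := inv_pos.2 hc
  have i1 := (memLp_coupledCurvature δ hγ hη hc hγc).integrable_sq.const_mul
    (2 * c⁻¹ ^ 2 + 3 / 2 * |δ| * c⁻¹ + 1 / 2)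
  have i2 := hγ.hasH1Deriv_deriv.memLp.norm.integrable_sq.const_mul (2 * c⁻¹ ^ 2)
  have i3 := hη.hasH1Deriv.memLp.norm.integrable_sq.const_mul
      (3 / 2 * |δ| * c⁻¹ + lam / 2 * c⁻¹ ^ 2)
  have i4 : Integrable (fun _ : ℝ => (1 : ℝ)) periodMeasure := integrable_const 1
  have h2 := hcrit.integral_coupledCurvature_sq_le hlam hγ hη hc hγc
  rw [hE.mean_eq, norm_smul, Real.norm_of_nonneg hpi.le, ← integral_periodMeasure]
  refine mul_le_mul_of_nonneg_left ?_ hpi.le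
  refine (norm_integral_le_integral_norm _).trans ((integral_mono
    (integrable_densityDerivP δ hlam hγ hη hc hγc).norm (((i1.add i2).add i3).add i4)
    fun x => norm_densityDerivP_le δ hlam hc (hγc x) _ _).trans ?_)
  have e1 := integral_add ((i1.add i2).add i3) i4
  have e2 := integral_add (i1.add i2) i3
  have e3 := integral_add i1 i2
  simp only [Pi.add_apply] at e1 e2 e3 ⊢
  rw [e1, e2, e3, integral_const_mul, integral_const_mul, integral_const_mul,
    integral_const_periodMeasure, smul_eq_mul, mul_one]
  have n1 : 0 ≤ ∫ x, coupledCurvature δ c (deriv γ x) (deriv (deriv γ) x) (deriv η x) ^ 2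
    ∂periodMeasure := integral_nonneg fun x => by positivity
  have n2 : 0 ≤ ∫ x, ‖deriv (deriv γ) x‖ ^ 2 ∂periodMeasure := integral_nonneg fun x => by positivity
  have n3 : 0 ≤ ∫ x, ‖deriv η x‖ ^ 2 ∂periodMeasure := integral_nonneg fun x => by positivity
  have hD0 : 0 ≤ D := hci.le.trans hD
  gcongr

/-- As W' is affine in W, the L¹ bound on W controls the total variation of W, and hence its
supremum. -/
theorem EulerLagrange.abs_curv_le (hE : EulerLagrange δ lam c γ η W a b)
    (hlam : 0 < lam) (hγ : MemHPer 2 γ) (hη : MemHPer 1 η) (hc : 0 < c)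
    (hγc : ∀ x, ‖deriv γ x‖ = c) (hcrit : IsCriticalPoint δ lam γ η) (x : ℝ) :
    |W x| ≤ (2 * Real.pi)⁻¹ * (3 * Real.pi) + (|δ| / lam * ‖a‖ * (3 * Real.pi)
      + 2 * Real.pi * (‖b‖ * c)) := by
  have hWc : Continuous W := continuous_iff_continuousAt.2 fun x =>
    (hE.hasDerivAt_curv x).continuousAt
  have hpc := hγ.hasH1Deriv_deriv.continuous
  have hJc : Continuous fun x => rot (deriv γ x) := rotL.continuous.comp hpc
  have hdc : Continuous fun x => δ / (c * lam) * W x * inner ℝ a (rot (deriv γ x))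
      - inner ℝ b (rot (deriv γ x)) :=
    ((continuous_const.mul hWc).mul (continuous_const.inner hJc)).sub (continuous_const.inner hJc)
  have hP := IsPrimitive.of_hasDerivAt hE.hasDerivAt_curv hdc
  have h1 := hP.norm_le hE.periodic x
  have h2 := hE.integral_norm_curv_le hlam hγ hη hc hγc hcrit
  have hpi := inv_pos.2 two_pi_pos
  have i1 : Integrable (fun x => ‖W x‖) periodMeasure :=
    (hWc.norm.memLp_periodMeasure 1).integrable le_rfl
  have h3 : ∫ t, ‖δ / (c * lam) * W t * inner ℝ a (rot (deriv γ t))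
      - inner ℝ b (rot (deriv γ t))‖ ∂periodMeasure
      ≤ ∫ t, (|δ| / lam * ‖a‖ * ‖W t‖ + ‖b‖ * c) ∂periodMeasure := by
    refine integral_mono ((hdc.norm.memLp_periodMeasure 1).integrable le_rfl)
      ((i1.const_mul _).add (integrable_const _)) fun t => ?_
    have e1 : |inner ℝ a (rot (deriv γ t))| ≤ ‖a‖ * c := by
      simpa [norm_rot, hγc t] using abs_real_inner_le_norm a (rot (deriv γ t))
    have e2 : |inner ℝ b (rot (deriv γ t))| ≤ ‖b‖ * c := by
      simpa [norm_rot, hγc t] using abs_real_inner_le_norm b (rot (deriv γ t))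
    refine (norm_sub_le _ _).trans (add_le_add ?_ e2)
    rw [norm_mul, norm_mul, norm_div, Real.norm_of_nonneg (mul_pos hc hlam).le,
      Real.norm_eq_abs δ, Real.norm_eq_abs (inner ℝ a _)]
    calc _ ≤ |δ| / (c * lam) * ‖W t‖ * (‖a‖ * c) := by gcongr
      _ = _ := by field_simp
  rw [integral_add (i1.const_mul _) (integrable_const _), integral_const_mul,
    integral_const_periodMeasure, smul_eq_mul] at h3
  refine h1.trans (add_le_add ?_ (h3.trans ?_))
  · exact mul_le_mul_of_nonneg_left ((norm_integral_le_integral_norm _).trans h2) hpi.le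
  · gcongr

theorem HasH1Deriv.norm_le {f g : ℝ → Plane} (h : HasH1Deriv f g) {A B : ℝ}
    (hA : ∫ x, ‖f x‖ ^ 2 ∂periodMeasure ≤ A) (hB : ∫ x, ‖g x‖ ^ 2 ∂periodMeasure ≤ B) (x : ℝ) :
    ‖f x‖ ≤ (2 * Real.pi)⁻¹ * (Real.pi + 1 / 2 * A) + (Real.pi + 1 / 2 * B) := by
  have hpi := inv_pos.2 two_pi_pos
  have h1 := h.isPrimitive.norm_le h.periodic x
  have h2 := integral_norm_le_of_memLp (h.continuous.memLp_periodMeasure 2)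
  have h3 := integral_norm_le_of_memLp h.memLp
  refine h1.trans (add_le_add (mul_le_mul_of_nonneg_left ?_ hpi.le) (by linarith))
  refine (norm_integral_le_integral_norm _).trans ?_
  linarith

/-- All the data of the Euler-Lagrange system of a critical point are bounded in terms of the
Sobolev norms of the critical point. -/
theorem exists_bound_eulerLagrange (δ : ℝ) (hlam : 0 < lam) (A B : ℝ) :
    ∃ M : ℝ, ∀ (c : ℝ) (γ η : ℝ → Plane) (W : ℝ → ℝ) (a b : Plane),
      EulerLagrange δ lam c γ η W a b → MemHPer 2 γ → MemHPer 1 η → 0 < c →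
      (∀ x, ‖deriv γ x‖ = c) → IsCriticalPoint δ lam γ η → hNorm 2 γ = A → hNorm 1 η = B →
      c⁻¹ ≤ M ∧ c ≤ M ∧ ‖a‖ ≤ M ∧ ‖b‖ ≤ M ∧ (∀ x, |W x| ≤ M) ∧ (∀ x, ‖γ x‖ ≤ M) ∧
        ∀ x, ‖η x‖ ≤ M := by
  -- D bounds c⁻¹, and K₁ to K₅ bound a, b, W, γ and η in this order. All are nonnegative, so their
  -- sum together with |A|, which bounds c, serves as M.
  obtain ⟨D, hD⟩ : ∃ D, D = 3 * Real.pi + |δ| * (Real.pi + 2 * Real.pi / lam) := ⟨_, rfl⟩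
  obtain ⟨K₁, hK₁⟩ : ∃ K, K = (2 * Real.pi)⁻¹ * (|δ| * |A| * (3 * Real.pi)) := ⟨_, rfl⟩
  obtain ⟨K₂, hK₂⟩ : ∃ K, K = (2 * Real.pi)⁻¹ *
      ((2 * D ^ 2 + 3 / 2 * |δ| * D + 1 / 2) * (4 * Real.pi) + 2 * D ^ 2 * A ^ 2
      + (3 / 2 * |δ| * D + lam / 2 * D ^ 2) * B ^ 2 + 2 * Real.pi) := ⟨_, rfl⟩
  obtain ⟨K₃, hK₃⟩ : ∃ K, K = (2 * Real.pi)⁻¹ * (3 * Real.pi)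
      + (|δ| / lam * K₁ * (3 * Real.pi) + 2 * Real.pi * (K₂ * |A|)) := ⟨_, rfl⟩
  obtain ⟨K₄, hK₄⟩ : ∃ K, K = (2 * Real.pi)⁻¹ * (Real.pi + 1 / 2 * A ^ 2)
      + (Real.pi + 1 / 2 * A ^ 2) := ⟨_, rfl⟩
  obtain ⟨K₅, hK₅⟩ : ∃ K, K = (2 * Real.pi)⁻¹ * (Real.pi + 1 / 2 * B ^ 2)
      + (Real.pi + 1 / 2 * B ^ 2) := ⟨_, rfl⟩
  have p0 : 0 ≤ D := by rw [hD]; positivity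
  have p1 : 0 ≤ K₁ := by rw [hK₁]; positivity
  have p2 : 0 ≤ K₂ := by rw [hK₂]; positivity
  have p3 : 0 ≤ K₃ := by rw [hK₃]; positivity
  have p4 : 0 ≤ K₄ := by rw [hK₄]; positivity
  have p5 : 0 ≤ K₅ := by rw [hK₅]; positivity
  have p6 := abs_nonneg A
  refine ⟨D + |A| + K₁ + K₂ + K₃ + K₄ + K₅, fun c γ η W a b hE hγ hη hc hγc hcrit hA hB => ?_⟩
  have n0 : ∫ x, ‖γ x‖ ^ 2 ∂periodMeasure ≤ A ^ 2 := by
    simpa [hA] using integral_norm_iteratedDeriv_sq_le γ (show 0 ≤ 2 by norm_num)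
  have n1 : ∫ x, ‖deriv γ x‖ ^ 2 ∂periodMeasure ≤ A ^ 2 := by
    simpa [hA] using integral_norm_iteratedDeriv_sq_le γ (show 1 ≤ 2 by norm_num)
  have n2 : ∫ x, ‖deriv (deriv γ) x‖ ^ 2 ∂periodMeasure ≤ A ^ 2 := by
    simpa [hA, iteratedDeriv_succ] using integral_norm_iteratedDeriv_sq_le γ (le_refl 2)
  have n3 : ∫ x, ‖η x‖ ^ 2 ∂periodMeasure ≤ B ^ 2 := by
    simpa [hB] using integral_norm_iteratedDeriv_sq_le η (show 0 ≤ 1 by norm_num)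
  have n4 : ∫ x, ‖deriv η x‖ ^ 2 ∂periodMeasure ≤ B ^ 2 := by
    simpa [hB] using integral_norm_iteratedDeriv_sq_le η (le_refl 1)
  have hcA : c ≤ |A| := by
    simp only [hγc] at n1
    rw [integral_const_periodMeasure, smul_eq_mul] at n1
    rw [← abs_of_pos hc]
    refine sq_le_sq.1 ?_
    nlinarith [Real.pi_gt_three, sq_nonneg c]
  have hcD : c⁻¹ ≤ D := hD ▸ hcrit.inv_speed_le hlam hγ hη hc hγc
  have ha : ‖a‖ ≤ K₁ := by
    refine (hE.norm_a_le hη hlam hγc hγ).trans ?_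
    have := hE.integral_norm_curv_le hlam hγ hη hc hγc hcrit
    rw [hK₁]
    gcongr
  have hb : ‖b‖ ≤ K₂ := hK₂ ▸ hE.norm_b_le hlam hγ hη hc hγc hcrit hcD n2 n4
  have hW : ∀ x, |W x| ≤ K₃ := fun x => by
    refine (hE.abs_curv_le hlam hγ hη hc hγc hcrit x).trans ?_
    rw [hK₃]
    gcongr
  have hγH : HasH1Deriv γ (deriv γ) :=
    ⟨hγ.periodic, hγ.hasH1Deriv_deriv.periodic,
      IsPrimitive.of_hasDerivAt hγ.hasDerivAt hγ.hasH1Deriv_deriv.continuous,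
      hγ.hasH1Deriv_deriv.continuous.memLp_periodMeasure 2⟩
  have hγb : ∀ x, ‖γ x‖ ≤ K₄ := hK₄ ▸ hγH.norm_le n0 n1
  have hηb : ∀ x, ‖η x‖ ≤ K₅ := hK₅ ▸ hη.hasH1Deriv.norm_le n3 n4
  refine ⟨by linarith, by linarith, by linarith, by linarith, fun x => ?_, fun x => ?_, fun x => ?_⟩
  · linarith [hW x]
  · linarith [hγb x]
  · linarith [hηb x]

end UniformBounds

/-! ### Bootstrapping with uniform bounds -/

section UniformlySmooth

/-- The functions of the family are `n` times differentiable, with bounds on their values and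
derivatives that are uniform over the family. -/
def UniformlySmooth {ι E : Type*} [NormedAddCommGroup E] [NormedSpace ℝ E] :
    ℕ → (ι → ℝ → E) → Prop
  | 0, f => ∃ M : ℝ, ∀ i x, ‖f i x‖ ≤ M
  | n + 1, f => (∃ M : ℝ, ∀ i x, ‖f i x‖ ≤ M) ∧
      ∃ g : ι → ℝ → E, (∀ i x, HasDerivAt (f i) (g i x) x) ∧ UniformlySmooth n g

namespace UniformlySmooth

variable {ι E F G : Type*} [NormedAddCommGroup E] [NormedSpace ℝ E] [NormedAddCommGroup F]
  [NormedSpace ℝ F] [NormedAddCommGroup G] [NormedSpace ℝ G] {n : ℕ} {f g : ι → ℝ → E}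

theorem bounded (h : UniformlySmooth n f) : ∃ M : ℝ, ∀ i x, ‖f i x‖ ≤ M := by
  cases n with
  | zero => exact h
  | succ n => exact h.1

theorem of_succ (h : UniformlySmooth (n + 1) f) : UniformlySmooth n f := by
  induction n generalizing f with
  | zero => exact h.1
  | succ n ih =>
    obtain ⟨h0, g, hg, hg'⟩ := h
    exact ⟨h0, g, hg, ih hg'⟩

theorem const {a : ι → E} {M : ℝ} (h : ∀ i, ‖a i‖ ≤ M) :
    UniformlySmooth n (fun i _ => a i) := by
  induction n generalizing a M with
  | zero => exact ⟨M, fun i _ => h i⟩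
  | succ n ih =>
    exact ⟨⟨M, fun i _ => h i⟩, fun _ _ => 0, fun i x => hasDerivAt_const x (a i),
      ih (M := 0) (fun _ => by simp)⟩

theorem add (hf : UniformlySmooth n f) (hg : UniformlySmooth n g) :
    UniformlySmooth n (fun i x => f i x + g i x) := by
  have hb : ∃ M : ℝ, ∀ i x, ‖f i x + g i x‖ ≤ M := by
    obtain ⟨M, hM⟩ := hf.bounded
    obtain ⟨N, hN⟩ := hg.bounded
    exact ⟨M + N, fun i x => (norm_add_le _ _).trans (add_le_add (hM i x) (hN i x))⟩
  induction n generalizing f g with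
  | zero => exact hb
  | succ n ih =>
    obtain ⟨-, f', hf1, hf2⟩ := hf
    obtain ⟨-, g', hg1, hg2⟩ := hg
    refine ⟨hb, _, fun i x => (hf1 i x).add (hg1 i x), ih hf2 hg2 ?_⟩
    obtain ⟨M, hM⟩ := hf2.bounded
    obtain ⟨N, hN⟩ := hg2.bounded
    exact ⟨M + N, fun i x => (norm_add_le _ _).trans (add_le_add (hM i x) (hN i x))⟩

theorem clm (L : E →L[ℝ] F) (hf : UniformlySmooth n f) :
    UniformlySmooth n (fun i x => L (f i x)) := by
  have hb : ∀ {u : ι → ℝ → E}, (∃ M : ℝ, ∀ i x, ‖u i x‖ ≤ M) → ∃ M : ℝ, ∀ i x, ‖L (u i x)‖ ≤ M := by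
    rintro u ⟨M, hM⟩
    exact ⟨‖L‖ * M, fun i x => L.le_opNorm_of_le (hM i x)⟩
  induction n generalizing f with
  | zero => exact hb hf
  | succ n ih =>
    obtain ⟨h0, f', hf1, hf2⟩ := hf
    exact ⟨hb h0, _, fun i x => L.hasFDerivAt.comp_hasDerivAt x (hf1 i x), ih hf2⟩

/-- The Leibniz rule, from which `smul`, `mul` and `inner` follow. The derivative pairs one factor
with the derivative of the other, so the undifferentiated factor is used one order lower. -/
theorem bilin (B : E →L[ℝ] F →L[ℝ] G) {v : ι → ℝ → F} (hf : UniformlySmooth n f)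
    (hv : UniformlySmooth n v) : UniformlySmooth n (fun i x => B (f i x) (v i x)) := by
  have hb : ∀ {u : ι → ℝ → E} {v : ι → ℝ → F}, (∃ M : ℝ, ∀ i x, ‖u i x‖ ≤ M) →
      (∃ M : ℝ, ∀ i x, ‖v i x‖ ≤ M) → ∃ M : ℝ, ∀ i x, ‖B (u i x) (v i x)‖ ≤ M := by
    rintro u v ⟨M, hM⟩ ⟨N, hN⟩
    refine ⟨‖B‖ * M * N, fun i x => ?_⟩
    exact (B (u i x)).le_of_opNorm_le_of_le (B.le_opNorm_of_le (hM i x)) (hN i x)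
  induction n generalizing f v with
  | zero => exact hb hf hv
  | succ n ih =>
    have hf0 := hf.of_succ
    have hv0 := hv.of_succ
    obtain ⟨h0, f', hf1, hf2⟩ := hf
    obtain ⟨h1, v', hv1, hv2⟩ := hv
    exact ⟨hb h0 h1, _, fun i x => B.hasDerivAt_of_bilinear (fun _ => hf1 i x) (fun _ => hv1 i x),
      (ih hf0 hv2).add (ih hf2 hv0)⟩

theorem smul {a : ι → ℝ → ℝ} (ha : UniformlySmooth n a) (hf : UniformlySmooth n f) :
    UniformlySmooth n (fun i x => a i x • f i x) :=
  ha.bilin (ContinuousLinearMap.lsmul ℝ ℝ) hf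

theorem mul {u v : ι → ℝ → ℝ} (hu : UniformlySmooth n u) (hv : UniformlySmooth n v) :
    UniformlySmooth n (fun i x => u i x * v i x) :=
  hu.smul hv

theorem inner {u v : ι → ℝ → Plane} (hu : UniformlySmooth n u) (hv : UniformlySmooth n v) :
    UniformlySmooth n (fun i x => inner ℝ (u i x) (v i x)) :=
  hu.bilin (isBoundedBilinearMap_inner (𝕜 := ℝ) (E := Plane)).toContinuousLinearMap hv

theorem neg (hf : UniformlySmooth n f) : UniformlySmooth n (fun i x => -f i x) :=
  hf.clm (-ContinuousLinearMap.id ℝ E)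

theorem sub (hf : UniformlySmooth n f) (hg : UniformlySmooth n g) :
    UniformlySmooth n (fun i x => f i x - g i x) := by
  simpa only [sub_eq_add_neg] using hf.add hg.neg

/-- One order is lost because the last level of `UniformlySmooth` records a bound without
continuity. -/
theorem contDiff (h : UniformlySmooth (n + 1) f) (i : ι) : ContDiff ℝ n (f i) := by
  induction n generalizing f with
  | zero =>
    obtain ⟨-, g, hg, -⟩ := h
    exact contDiff_zero.2 (continuous_iff_continuousAt.2 fun x => (hg i x).continuousAt)
  | succ n ih =>
    obtain ⟨-, g, hg, hg'⟩ := h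
    have hd : deriv (f i) = g i := funext fun x => (hg i x).deriv
    push_cast
    rw [contDiff_succ_iff_deriv, hd]
    exact ⟨fun x => (hg i x).differentiableAt, by simp, ih hg'⟩

theorem iteratedDeriv_bounded (h : UniformlySmooth n f) {j : ℕ} (hj : j ≤ n) :
    ∃ M : ℝ, ∀ i x, ‖iteratedDeriv j (f i) x‖ ≤ M := by
  induction n generalizing f j with
  | zero =>
    obtain rfl : j = 0 := by omega
    simpa using h.bounded
  | succ n ih =>
    cases j with
    | zero => simpa using h.bounded
    | succ j =>
      obtain ⟨-, g, hg, hg'⟩ := h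
      obtain ⟨M, hM⟩ := ih hg' (show j ≤ n by omega)
      refine ⟨M, fun i x => ?_⟩
      have hd : deriv (f i) = g i := funext fun x => (hg i x).deriv
      rw [iteratedDeriv_succ', hd]
      exact hM i x

theorem wInftyNorm_le {f : ι → ℝ → Plane} (h : UniformlySmooth n f) :
    ∃ C : ℝ, 0 ≤ C ∧ ∀ i, wInftyNorm n (f i) ≤ ENNReal.ofReal C := by
  have h1 : ∀ j : ℕ, ∃ M : ℝ, 0 ≤ M ∧ (j ≤ n → ∀ i x, ‖iteratedDeriv j (f i) x‖ ≤ M) := by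
    intro j
    by_cases hj : j ≤ n
    · obtain ⟨M, hM⟩ := h.iteratedDeriv_bounded hj
      -- An empty family would allow a negative M, hence the absolute value.
      exact ⟨|M|, abs_nonneg M, fun _ i x => (hM i x).trans (le_abs_self M)⟩
    · exact ⟨0, le_rfl, fun h => absurd h hj⟩
  choose M hM0 hM using h1
  refine ⟨∑ j ∈ Finset.range (n + 1), M j, Finset.sum_nonneg fun j _ => hM0 j, fun i => ?_⟩
  rw [ENNReal.ofReal_sum_of_nonneg fun j _ => hM0 j, wInftyNorm]
  refine Finset.sum_le_sum fun j hj => ?_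
  rw [Finset.mem_range] at hj
  rw [eLpNorm_exponent_top]
  exact eLpNormEssSup_le_of_ae_bound (Filter.Eventually.of_forall (hM j (by omega) i))

end UniformlySmooth

/-- Critical points of `E_LM` parametrized proportionally to arc length, with prescribed Sobolev
norms. -/
structure IsNormedCriticalPoint (δ lam A B : ℝ) (γ η : ℝ → Plane) : Prop where
  memHImm : MemHImm γ
  memHPer : MemHPer 1 η
  proportional : IsProportionalToArcLength γ
  critical : IsCriticalPoint δ lam γ η
  hNorm_curve : hNorm 2 γ = A
  hNorm_field : hNorm 1 η = B

/-- The index type collects all critical points with the given norms, so a bound uniform in the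
index depends on δ, λ, A, B and the order only. -/
theorem uniformlySmooth_criticalPoints (δ : ℝ) {lam : ℝ} (hlam : 0 < lam) (A B : ℝ) (n : ℕ) :
    UniformlySmooth n (fun i : {u : (ℝ → Plane) × (ℝ → Plane) //
        IsNormedCriticalPoint δ lam A B u.1 u.2} => i.1.1) ∧
      UniformlySmooth n (fun i : {u : (ℝ → Plane) × (ℝ → Plane) //
        IsNormedCriticalPoint δ lam A B u.1 u.2} => i.1.2) := by
  set ι := {u : (ℝ → Plane) × (ℝ → Plane) // IsNormedCriticalPoint δ lam A B u.1 u.2} with hι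
  set γ : ι → ℝ → Plane := fun i => i.1.1 with hγdef
  set η : ι → ℝ → Plane := fun i => i.1.2 with hηdef
  set c : ι → ℝ := fun i => curveLength (γ i) / (2 * Real.pi) with hcdef
  have hγ : ∀ i, MemHPer 2 (γ i) := fun i => i.2.memHImm.memHPer
  have hη : ∀ i, MemHPer 1 (η i) := fun i => i.2.memHPer
  have hγc : ∀ i x, ‖deriv (γ i) x‖ = c i := fun i => i.2.proportional
  have hcrit : ∀ i, IsCriticalPoint δ lam (γ i) (η i) := fun i => i.2.critical
  have hc : ∀ i, 0 < c i := fun i => by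
    rw [← hγc i 0]
    exact norm_pos_iff.2 (i.2.memHImm.regular 0)
  choose W a b hE using fun i =>
    (hcrit i).exists_eulerLagrange hlam (hγ i) (hη i) (hc i) (hγc i)
  obtain ⟨M, hM⟩ := exists_bound_eulerLagrange δ hlam A B
  have hMi := fun i => hM (c i) (γ i) (η i) (W i) (a i) (b i) (hE i) (hγ i) (hη i) (hc i) (hγc i)
    (hcrit i) i.2.hNorm_curve i.2.hNorm_field
  have hcU : ∀ n, UniformlySmooth n (fun (i : ι) (_ : ℝ) => c i) := fun n =>
    .const (M := M) fun i => by rw [Real.norm_of_nonneg (hc i).le]; exact (hMi i).2.1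
  have hciU : ∀ n, UniformlySmooth n (fun (i : ι) (_ : ℝ) => (c i)⁻¹) := fun n =>
    .const (M := M) fun i => by
      rw [Real.norm_of_nonneg (inv_pos.2 (hc i)).le]; exact (hMi i).1
  have haU : ∀ n, UniformlySmooth n (fun (i : ι) (_ : ℝ) => a i) := fun n =>
    .const (M := M) fun i => (hMi i).2.2.1
  have hbU : ∀ n, UniformlySmooth n (fun (i : ι) (_ : ℝ) => b i) := fun n =>
    .const (M := M) fun i => (hMi i).2.2.2.1
  have hk : ∀ (t : ℝ) n, UniformlySmooth n (fun (_ : ι) (_ : ℝ) => t) := fun t n =>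
    .const (M := ‖t‖) fun _ => le_rfl
  -- The right-hand sides are polynomial in p, W and the bounded constants a, b, c, c⁻¹; bounds of
  -- order n for p and W thus give bounds of order n for their derivatives.
  have key : ∀ n, UniformlySmooth n (fun i => deriv (γ i)) ∧ UniformlySmooth n W := by
    intro n
    induction n with
    | zero =>
      exact ⟨⟨M, fun i x => by rw [hγc]; exact (hMi i).2.1⟩,
        ⟨M, fun i x => (hMi i).2.2.2.2.1 x⟩⟩
    | succ n ih =>
      obtain ⟨ihp, ihW⟩ := ih
      have hJ : UniformlySmooth n (fun i x => rot (deriv (γ i) x)) := ihp.clm rotL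
      refine ⟨⟨ihp.bounded, _, fun i => (hE i).hasDerivAt_deriv, ?_⟩,
        ⟨ihW.bounded, _, fun i => (hE i).hasDerivAt_curv, ?_⟩⟩
      · have h1 := ((hcU n).mul (((hk (1 + δ ^ 2 / lam) n).mul ihW).sub
          (((hk (δ / lam) n).mul ((hciU n).mul (hciU n))).mul ((haU n).inner ihp)))).smul hJ
        convert h1 using 6
        field_simp
      · have h1 := ((((hk (δ / lam) n).mul (hciU n)).mul ihW).mul ((haU n).inner hJ)).sub
          ((hbU n).inner hJ)
        convert h1 using 6
        field_simp
  cases n with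
  | zero => exact ⟨⟨M, fun i x => (hMi i).2.2.2.2.2.1 x⟩, ⟨M, fun i x => (hMi i).2.2.2.2.2.2 x⟩⟩
  | succ n =>
    -- γ and η gain one order, their derivatives being p and a polynomial in p and W.
    obtain ⟨hp, hW⟩ := key n
    refine ⟨⟨⟨M, fun i x => (hMi i).2.2.2.2.2.1 x⟩, _, fun i => (hγ i).hasDerivAt, hp⟩,
      ⟨⟨M, fun i x => (hMi i).2.2.2.2.2.2 x⟩, _, fun i => (hE i).hasDerivAt_field, ?_⟩⟩
    exact (hk lam⁻¹ n).smul ((haU n).sub (((hk δ n).mul hW).smul hp))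

end UniformlySmooth

end SurfactantCurve

theorem theorem4p5 (δ lam : ℝ) (hlam : 0 < lam) :
    (∀ γ η : ℝ → SurfactantCurve.Plane,
      SurfactantCurve.MemHImm γ → SurfactantCurve.MemHPer 1 η →
      SurfactantCurve.IsProportionalToArcLength γ →
      SurfactantCurve.IsCriticalPoint δ lam γ η →
        SurfactantCurve.MemCInftyPer γ ∧ SurfactantCurve.MemCInftyPer η) ∧
    ∀ k : ℕ, ∃ C : ℝ → ℝ → ℝ, ∀ γ η : ℝ → SurfactantCurve.Plane,
      SurfactantCurve.MemHImm γ → SurfactantCurve.MemHPer 1 η →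
      SurfactantCurve.IsProportionalToArcLength γ →
      SurfactantCurve.IsCriticalPoint δ lam γ η →
        SurfactantCurve.wInftyNorm (k + 2) γ + SurfactantCurve.wInftyNorm (k + 1) η ≤
          ENNReal.ofReal (C (SurfactantCurve.hNorm 2 γ) (SurfactantCurve.hNorm 1 η)) := by
  constructor
  · intro γ η hγ hη hprop hcrit
    -- Smoothness of one critical point is read off from the family with its own norms.
    have h := SurfactantCurve.uniformlySmooth_criticalPoints δ hlam
      (SurfactantCurve.hNorm 2 γ) (SurfactantCurve.hNorm 1 η)
    have hi : SurfactantCurve.IsNormedCriticalPoint δ lam (SurfactantCurve.hNorm 2 γ)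
      (SurfactantCurve.hNorm 1 η) γ η := ⟨hγ, hη, hprop, hcrit, rfl, rfl⟩
    exact ⟨⟨hγ.memHPer.periodic, contDiff_infty.2 fun n => (h (n + 1)).1.contDiff ⟨(γ, η), hi⟩⟩,
      ⟨hη.periodic, contDiff_infty.2 fun n => (h (n + 1)).2.contDiff ⟨(γ, η), hi⟩⟩⟩
  · intro k
    -- A constant is chosen separately for each pair of norms, so no monotonicity in A and B is
    -- needed.
    choose C hC0 hC using fun A B =>
      (SurfactantCurve.uniformlySmooth_criticalPoints δ hlam A B (k + 2)).1.wInftyNorm_le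
    choose C' hC0' hC' using fun A B =>
      (SurfactantCurve.uniformlySmooth_criticalPoints δ hlam A B (k + 1)).2.wInftyNorm_le
    refine ⟨fun A B => C A B + C' A B, fun γ η hγ hη hprop hcrit => ?_⟩
    have hi : SurfactantCurve.IsNormedCriticalPoint δ lam (SurfactantCurve.hNorm 2 γ)
      (SurfactantCurve.hNorm 1 η) γ η := ⟨hγ, hη, hprop, hcrit, rfl, rfl⟩
    rw [ENNReal.ofReal_add (hC0 _ _) (hC0' _ _)]
    exact add_le_add (hC _ _ ⟨(γ, η), hi⟩) (hC' _ _ ⟨(γ, η), hi⟩)
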